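/- **Model.** Fix $n\ge 2$ and $\sigma_F>0$. A leader $L$ who observes the state $\theta\in\mathbb R$ chooses $a_L\in\{\mathcal E,\mathcal N\}$. Followers $j=1,\dots,n$ observe $h=a_L$ and private signals $x_j=\theta+\sigma_F\varepsilon_j$, with $\varepsilon_j$ i.i.d. standard Gaussian and independent of $\theta$; the common prior on $\theta$ is the improper uniform one. They then choose simultaneously in $\{\mathcal E,\mathcal N\}$; a follower strategy is a map $s_j:h\mapsto s_j(h)$. Player $i$ gets $\theta+A_{-i}-1$ from $\mathcal E$, where $A_{-i}$ is $1/n$ times the number of other players who choose $\mathcal E$, and $0$ from $\mathcal N$; ties are broken in favour of $\mathcal N$. **$\Delta$-rationalizability.** An admissible belief of leader type $\theta$ is a probability measure on the followers' type-strategy pairs under which the signals are distributed as $(\theta+\sigma_F\varepsilon_k)_k$. An admissible belief of follower $j$ with signal $x$ after $h$ is a probability measure on the type-strategy pairs of the leader and the other followers for which there is a threshold $z\in\mathbb R$ such that the leader's action is $h$, the state has the law $\Psi^h(\cdot\,;x,z)$, i.e. $N(x,\sigma_F^2)$ conditioned on $\{\theta>z\}$ if $h=\mathcal E$ and on $\{\theta\le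 z\}$ if $h=\mathcal N$ (Bayes' rule, when the leader is believed to choose $\mathcal E$ iff $\theta>z$), and, given $\theta$, the other signals are $\theta+\sigma_F\varepsilon_k$. The strategies are otherwise unrestricted. Let $R_L^0$ and $R_{F,j}^0$ be the sets of all type-strategy pairs. For $k\ge1$, $(\theta,a_L)\in R_L^k$ iff $(\theta,a_L)\in R_L^{k-1}$ and $a_L$ is optimal for some admissible belief concentrated on $\prod_j R_{F,j}^{k-1}$; and $(x,s_j)\in R_{F,j}^k$ iff $(x,s_j)\in R_{F,j}^{k-1}$ and for each $h$ the action $s_j(h)$ is optimal for some admissible belief concentrated on $R_L^k\times\prod_{\ell\ne j}R_{F,\ell}^{k-1}$. Put $R^\infty=\bigcap_k R^k$. **Thresholds.** Let $\Phi$ be the standard Gaussian distribution function, with $\Phi(-\infty)=0$ and $\Phi(\infty)=1$, and let $$\pi_L(\theta;x')=\theta-\Phi\Big(\tfrac{x'-\theta}{\sigma_F}\Big),\qquad \pi_F^h(x;z,x')=\mathbb E_{\theta\sim\Psi^h(\cdot;x,z)}\Big[\theta-\tfrac{n-1}{n}\Phi\Big(\tfrac{x'-\theta}{\sigma_F}\Big)\Big]-\tfrac1n\mathbb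 1(h=\mathcal N).$$ Let $\mathrm{BR}_L(x')$ be the unique zero of $\pi_L(\cdot\,;x')$, and $\mathrm{BR}_F^h(z,x')$ the unique zero of $\pi_F^h(\cdot\,;z,x')$ if it exists, and otherwise $-\infty$ if $h=\mathcal E$ and $\infty$ if $h=\mathcal N$. Start from $\underline\theta_L^0=\underline x_h^0=-\infty$, $\overline\theta_L^0=\overline x_h^0=\infty$ and set $$\underline\theta_L^k=\mathrm{BR}_L(\underline x_{\mathcal E}^{k-1}),\quad \overline\theta_L^k=\mathrm{BR}_L(\overline x_{\mathcal E}^{k-1}),\quad \underline x_h^k=\mathrm{BR}_F^h(\overline\theta_L^k,\underline x_h^{k-1}),\quad \overline x_h^k=\mathrm{BR}_F^h(\underline\theta_L^k,\overline x_h^{k-1}).$$ **Proposition 1.** (i) For every $\sigma_F>0$, $\underline\theta_L^k\to0$, and the limits $\overline\theta_L=\lim\overline\theta_L^k\in\mathbb R$, $\overline x_{\mathcal E}=\lim\overline x_{\mathcal E}^k$ and $\underline x_{\mathcal N}=\lim\underline x_{\mathcal N}^k$ (in $[-\infty,\infty]$) exist. The set $R_L^\infty$ consists of all $(\theta,a_L)$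 except those with $a_L=\mathcal E$ and $\theta\le0$ and those with $a_L=\mathcal N$ and $\theta>\overline\theta_L$. For each $j$, $R_{F,j}^\infty$ consists of all $(x,s_j)$ except those with $s_j(\mathcal E)=\mathcal N$ and $x>\overline x_{\mathcal E}$ and those with $s_j(\mathcal N)=\mathcal E$ and $x<\underline x_{\mathcal N}$. (ii) Rationalizable play is unique (every type of every player has exactly one rationalizable strategy) if and only if $(\overline\theta_L,\overline x_{\mathcal E},\underline x_{\mathcal N})=(0,-\infty,\infty)$. For each $n$ there is a unique real number $\widehat\sigma_F$ such that, for all $\sigma_F>0$, rationalizable play is unique with $(\overline\theta_L,\overline x_{\mathcal E},\underline x_{\mathcal N})=(0,-\infty,\infty)$ if and only if $\sigma_F>\widehat\sigma_F$. (iii) When rationalizable play is unique, the leader chooses $\mathcal E$ exactly when $\theta>0$, and every follower imitates the leader: $s_j(h)=h$ for every signal and every $h$. -/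

import Mathlib

open MeasureTheory ProbabilityTheory Filter Topology

noncomputable section

namespace LeaderGame

/-! ### The game -/

/-- The two actions: `E` (exert effort) and `N` (do not). The leader's action is also the
history that the followers observe. -/
inductive Act where
  | E
  | N
  deriving DecidableEq

instance : MeasurableSpace Act := ⊤

/-- A follower's strategy: an action after each action of the leader. -/
abbrev Strategy : Type := Act → Act

/-- The followers other than `j`. -/
abbrev Others (n : ℕ) (j : Fin n) : Type := {k : Fin n // k ≠ j}

/-- Payoff of effort in state `θ` when the proportion of other players (counted in units of
`1 / n`) who exert effort is `A`. Not exerting effort gives `0`. -/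
def payoff (θ A : ℝ) : ℝ := θ + A - 1

/-- `1` for effort, `0` for no effort. -/
def effort (a : Act) : ℝ := if a = Act.E then 1 else 0

/-- `A_{-L}` after the leader has exerted effort, for a profile of followers' strategies. -/
def leaderAggregate (n : ℕ) (s : Fin n → Strategy) : ℝ :=
  (∑ k, effort (s k Act.E)) / n

/-- `A_{-j}` after history `h`, for a profile of strategies of the followers other than `j`. -/
def followerAggregate (n : ℕ) (j : Fin n) (h : Act) (s : Others n j → Strategy) : ℝ :=
  (effort h + ∑ k, effort (s k h)) / n

/-- `a` is optimal when the expected payoff of effort is `v` (ties are broken for `N`). -/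
def Optimal (a : Act) (v : ℝ) : Prop := a = Act.E ↔ 0 < v

/-! ### Information and admissible beliefs -/

/-- The law of i.i.d. standard Gaussian noises indexed by `ι`. -/
def noise (ι : Type) [Fintype ι] : Measure (ι → ℝ) :=
  Measure.pi fun _ => gaussianReal 0 1

/-- The leader's threshold strategy with threshold `z`: effort iff `θ > z`. -/
def thresholdStrategy (z θ : ℝ) : Act := if z < θ then Act.E else Act.N

/-- The interim belief about the state of a follower with signal `x` after history `h` if he
believes that the leader uses the threshold strategy `z`. Under the uniform improper prior,
the belief given the signal alone is `N(x, σ²)`; Bayes' rule conditions it on the event that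
the leader's action is `h`. -/
def interim (σ x z : ℝ) (h : Act) : Measure ℝ :=
  ProbabilityTheory.cond (gaussianReal x (Real.toNNReal (σ ^ 2)))
    {θ | thresholdStrategy z θ = h}

/-- Admissible beliefs of the leader of type `θ` about the followers' type-strategy pairs:
the signals are `θ + σ ε_k` with i.i.d. standard Gaussian `ε_k`; the strategies are
unrestricted. -/
def LeaderBelief (n : ℕ) (σ θ : ℝ) (μ : Measure (Fin n → ℝ × Strategy)) : Prop :=
  IsProbabilityMeasure μ ∧
    μ.map (fun p k => (p k).1) = (noise (Fin n)).map (fun ε k => θ + σ * ε k)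

/-- Admissible beliefs of follower `j` with signal `x` after history `h` about the leader's
type-action pair and the other followers' type-strategy pairs: for some threshold `z`, the
state has the interim law `interim σ x z h`, the leader's action is `h`, and given the state
the other signals are `θ + σ ε_k` with i.i.d. standard Gaussian `ε_k`. The other followers'
strategies are unrestricted. -/
def FollowerBelief (n : ℕ) (σ : ℝ) (j : Fin n) (x : ℝ) (h : Act)
    (μ : Measure ((ℝ × Act) × (Others n j → ℝ × Strategy))) : Prop :=
  IsProbabilityMeasure μ ∧
    ∃ z : ℝ,
      μ.map (fun p => (p.1, fun k => (p.2 k).1)) =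
        ((interim σ x z h).prod (noise (Others n j))).map
          (fun q => ((q.1, h), fun k => q.1 + σ * q.2 k))

/-! ### `Δ`-rationalizability -/

/-- One round of elimination for the leader, given her current set `RL` and the followers'
current sets `RF`. -/
def leaderStep (n : ℕ) (σ : ℝ) (RL : Set (ℝ × Act)) (RF : Fin n → Set (ℝ × Strategy)) :
    Set (ℝ × Act) :=
  {p | p ∈ RL ∧ ∃ μ : Measure (Fin n → ℝ × Strategy),
    LeaderBelief n σ p.1 μ ∧ (∀ᵐ q ∂μ, ∀ k, q k ∈ RF k) ∧
      Optimal p.2 (∫ q, payoff p.1 (leaderAggregate n fun k => (q k).2) ∂μ)}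

/-- One round of elimination for the followers, given the leader's updated set `RL` and the
followers' current sets `RF`. -/
def followerStep (n : ℕ) (σ : ℝ) (RL : Set (ℝ × Act)) (RF : Fin n → Set (ℝ × Strategy))
    (j : Fin n) : Set (ℝ × Strategy) :=
  {p | p ∈ RF j ∧ ∀ h : Act,
    ∃ μ : Measure ((ℝ × Act) × (Others n j → ℝ × Strategy)),
      FollowerBelief n σ j p.1 h μ ∧ (∀ᵐ q ∂μ, q.1 ∈ RL ∧ ∀ k, q.2 k ∈ RF k.1) ∧
        Optimal (p.2 h)
          (∫ q, payoff q.1.1 (followerAggregate n j h fun k => (q.2 k).2) ∂μ)}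

/-- The pair `(R_L^k, (R_{F,j}^k)_j)`. -/
def ratRound (n : ℕ) (σ : ℝ) : ℕ → Set (ℝ × Act) × (Fin n → Set (ℝ × Strategy))
  | 0 => (Set.univ, fun _ => Set.univ)
  | k + 1 =>
    (leaderStep n σ (ratRound n σ k).1 (ratRound n σ k).2,
      followerStep n σ (leaderStep n σ (ratRound n σ k).1 (ratRound n σ k).2) (ratRound n σ k).2)

/-- `R_L^∞`. -/
def leaderRat (n : ℕ) (σ : ℝ) : Set (ℝ × Act) := ⋂ k, (ratRound n σ k).1

/-- `R_{F,j}^∞`. -/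
def followerRat (n : ℕ) (σ : ℝ) (j : Fin n) : Set (ℝ × Strategy) := ⋂ k, (ratRound n σ k).2 j

/-- There is exactly one rationalizable strategy profile: every type of every player has
exactly one rationalizable action or strategy. -/
def UniquePlay (n : ℕ) (σ : ℝ) : Prop :=
  (∀ θ : ℝ, ∃! a : Act, (θ, a) ∈ leaderRat n σ) ∧
    ∀ j : Fin n, ∀ x : ℝ, ∃! s : Strategy, (x, s) ∈ followerRat n σ j

/-! ### The dominance bounds -/

/-- `Φ((x - θ) / σ)` for an extended real `x`, with `Φ(-∞) = 0` and `Φ(∞) = 1`. -/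
def PhiExt (σ : ℝ) (x : EReal) (θ : ℝ) : ℝ :=
  if x = ⊥ then 0 else if x = ⊤ then 1 else cdf (gaussianReal 0 1) ((x.toReal - θ) / σ)

/-- The leader's payoff `π_L(θ; x)`. -/
def piL (σ θ : ℝ) (x : EReal) : ℝ := θ - PhiExt σ x θ

/-- The follower's payoff `π_F^h(x; z, x')`. -/
def piF (n : ℕ) (σ : ℝ) (h : Act) (x z : ℝ) (x' : EReal) : ℝ :=
  (∫ θ, (θ - ((n : ℝ) - 1) / n * PhiExt σ x' θ) ∂(interim σ x z h)) - (1 - effort h) / n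

/-- `BR_L(x)`: the unique `θ` with `π_L(θ; x) = 0`. -/
def brL (σ : ℝ) (x : EReal) : ℝ := Classical.epsilon fun θ : ℝ => piL σ θ x = 0

open Classical in
/-- `BR_F^h(z, x')`: the unique real `x` with `π_F^h(x; z, x') = 0` if there is one;
otherwise `-∞` after `E` and `∞` after `N`. -/
def brF (n : ℕ) (σ : ℝ) (h : Act) (z : ℝ) (x' : EReal) : EReal :=
  if H : ∃ x : ℝ, piF n σ h x z x' = 0 then ((H.choose : ℝ) : EReal)
  else if h = Act.E then ⊥ else ⊤

/-- Lower and upper dominance bounds of the leader, and of the followers after `E` and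
after `N`. -/
structure Bounds where
  thetaLo : EReal
  thetaHi : EReal
  xELo : EReal
  xEHi : EReal
  xNLo : EReal
  xNHi : EReal

/-- The six sequences of dominance bounds. -/
def bounds (n : ℕ) (σ : ℝ) : ℕ → Bounds
  | 0 =>
    { thetaLo := ⊥, thetaHi := ⊤, xELo := ⊥, xEHi := ⊤, xNLo := ⊥, xNHi := ⊤ }
  | k + 1 =>
    let b := bounds n σ k
    let lo := brL σ b.xELo
    let hi := brL σ b.xEHi
    { thetaLo := (lo : EReal)
      thetaHi := (hi : EReal)
      xELo := brF n σ Act.E hi b.xELo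
      xEHi := brF n σ Act.E lo b.xEHi
      xNLo := brF n σ Act.N hi b.xNLo
      xNHi := brF n σ Act.N lo b.xNHi }

/-- The leader's upper bounds, the followers' upper bounds after `E` and their lower bounds
after `N` converge to `θ`, `xE` and `xN`. -/
def LimitThresholds (n : ℕ) (σ : ℝ) (θ : ℝ) (xE xN : EReal) : Prop :=
  Tendsto (fun k => (bounds n σ k).thetaHi) atTop (𝓝 (θ : EReal)) ∧
    Tendsto (fun k => (bounds n σ k).xEHi) atTop (𝓝 xE) ∧
    Tendsto (fun k => (bounds n σ k).xNLo) atTop (𝓝 xN)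

end LeaderGame

end

open LeaderGame

namespace LeaderGame

/-! ### Gaussian preliminaries -/

/-! In every round the surviving sets are described by the dominance bounds (`ratRound_eq`). Payoffs
are affine in the others' efforts, so a belief matters only through the law of the state and each
opponent's expected effort. The extreme beliefs therefore let opponents use cutoff strategies at the
current bounds, or always or never exert effort. After effort the least favourable leader threshold
is the lowest one left, 0; after no effort the most favourable is the highest one left. Two sign
arguments support this. Gaussian laws with different means have a monotone likelihood ratio, so a
follower's expected gain crosses zero at most once in his own signal
(`setIntegral_gaussian_pos_of_nonneg`). The gain increases in the state, so moving the truncation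
point can change the sign in one direction only (`totalGain_E_of_le`, `totalGain_N_of_le`).

After effort the state is believed positive, so effort is always justified by the belief that all
others exert it. Hence the lower bound after effort stays at -∞ and the leader's lower bound is 0
from the first round on. The upper bounds after effort then obey a recursion of their own, x ↦ `brF
n σ Act.E 0 x`. They fall to -∞ exactly when the gain of a follower whose signal equals the common
cutoff is positive at every real cutoff (`iInf_xEHi_eq_bot_iff`). In that case the leader's upper
bound tends to 0. Once it is below 1/n, effort after no effort is dominated for every signal, so the
other limits come for free (`limitThresholds_of_iInf_xEHi`).

At signal and cutoff σt, the diagonal gain is σ E[(t+v)⁺] - ((n-1)/n) E[Φ(-v); v > -t]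
(`totalGain_diag`). It is positive for all t iff σ exceeds (n-1)/n times the maximum of a ratio that
does not depend on σ. This ratio is continuous and positive and vanishes at ±∞, so the maximum is
attained, and the cutoff inequality is strict. -/

theorem setOf_thresholdStrategy_E (z : ℝ) :
    {θ | thresholdStrategy z θ = Act.E} = Set.Ioi z := by
  ext θ; simp [thresholdStrategy]

theorem setOf_thresholdStrategy_N (z : ℝ) :
    {θ | thresholdStrategy z θ = Act.N} = Set.Iic z := by
  ext θ; simp [thresholdStrategy]

theorem measurableSet_thresholdStrategy (z : ℝ) (h : Act) :
    MeasurableSet {θ | thresholdStrategy z θ = h} := by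
  cases h
  · rw [setOf_thresholdStrategy_E]; exact measurableSet_Ioi
  · rw [setOf_thresholdStrategy_N]; exact measurableSet_Iic

theorem volume_thresholdStrategy_ne_zero (z : ℝ) (h : Act) :
    volume {θ | thresholdStrategy z θ = h} ≠ 0 := by
  cases h
  · rw [setOf_thresholdStrategy_E]; simp
  · rw [setOf_thresholdStrategy_N]; simp

theorem integrable_abs_stdGaussian : Integrable (fun v : ℝ => |v|) (gaussianReal 0 1) :=
  ((memLp_id_gaussianReal (μ := 0) (v := 1) 1).integrable (by simp)).abs

theorem integrable_id_gaussianReal (x : ℝ) (v : NNReal) :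
    Integrable (fun θ : ℝ => θ) (gaussianReal x v) :=
  (memLp_id_gaussianReal (μ := x) (v := v) 1).integrable (by simp)

instance : NullSingletonClass (gaussianReal 0 1) :=
  nullSingletonClass_gaussianReal (by simp)

theorem gaussianReal_ne_zero_of_volume {x : ℝ} {v : NNReal} (hv : v ≠ 0) {s : Set ℝ}
    (hs : volume s ≠ 0) : gaussianReal x v s ≠ 0 :=
  fun h => hs (gaussianReal_absolutelyContinuous' x hv h)

/-- Integrals of a parametrized integrand of linear growth over a half-line with a moving end
point are continuous in the parameter. -/
theorem continuous_integral_thresholdStrategy {X : Type*} [TopologicalSpace X]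
    [FirstCountableTopology X] {a : X → ℝ} (ha : Continuous a) {f : X → ℝ → ℝ}
    (hf : ∀ v, Continuous fun x => f x v) (hm : ∀ x, Measurable (f x))
    (hb : ∀ x₀, ∃ C, ∀ᶠ x in 𝓝 x₀, ∀ v, |f x v| ≤ C + C * |v|) (h : Act) :
    Continuous fun x => ∫ v in {v | thresholdStrategy (a x) v = h}, f x v ∂gaussianReal 0 1 := by
  rw [continuous_iff_continuousAt]
  intro x₀
  obtain ⟨C, hC⟩ := hb x₀
  simp_rw [← integral_indicator (measurableSet_thresholdStrategy _ h)]
  refine continuousAt_of_dominated (bound := fun v => C + C * |v|) ?_ ?_ ?_ ?_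
  · exact Eventually.of_forall fun x =>
      ((hm x).indicator (measurableSet_thresholdStrategy _ h)).aestronglyMeasurable
  · filter_upwards [hC] with x hx
    refine Eventually.of_forall fun v => ?_
    exact (norm_indicator_le_norm_self _ _).trans (hx v)
  · exact (integrable_const _).add (integrable_abs_stdGaussian.const_mul C)
  -- Away from the null point `a x₀`, membership in the half-line is locally constant in the
  -- parameter.
  · have hne : ∀ᵐ v ∂gaussianReal 0 1, v ≠ a x₀ := by
      simp [ae_iff]
    filter_upwards [hne] with v hv
    have hev : ∀ᶠ x in 𝓝 x₀, thresholdStrategy (a x) v = thresholdStrategy (a x₀) v := by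
      rcases lt_or_gt_of_ne hv with hlt | hgt
      · filter_upwards [ha.continuousAt.eventually (lt_mem_nhds hlt)] with x hx
        simp only [thresholdStrategy, if_neg hlt.not_gt]
        exact if_neg (not_lt.2 (le_of_lt hx))
      · filter_upwards [ha.continuousAt.eventually (gt_mem_nhds hgt)] with x hx
        simp only [thresholdStrategy, if_pos hgt]
        exact if_pos hx
    by_cases hh : thresholdStrategy (a x₀) v = h
    · refine ((hf v).continuousAt (x := x₀)).congr ?_
      filter_upwards [hev] with x hx
      rw [Set.indicator_of_mem]
      exact hx.trans hh
    · refine (continuousAt_const (y := (0 : ℝ))).congr ?_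
      filter_upwards [hev] with x hx
      rw [Set.indicator_of_notMem]
      exact fun hx' => hh (hx.symm.trans hx')

theorem continuous_cdf_stdGaussian : Continuous (cdf (gaussianReal 0 1)) := by
  have := continuous_integral_thresholdStrategy (a := fun x : ℝ => x) continuous_id
    (f := fun _ _ => (1 : ℝ)) (fun _ => continuous_const) (fun _ => measurable_const)
    (fun _ => ⟨1, Eventually.of_forall fun _ v => by simp⟩) Act.N
  refine this.congr fun x => ?_
  rw [setOf_thresholdStrategy_N, cdf_eq_real]
  simp

theorem strictMono_cdf_stdGaussian : StrictMono (cdf (gaussianReal 0 1)) := by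
  intro a b hab
  rw [cdf_eq_real, cdf_eq_real, ← Set.Iic_union_Ioc_eq_Iic hab.le]
  have hd : Disjoint (Set.Iic a) (Set.Ioc a b) :=
    Set.disjoint_left.2 fun x hx hx' => not_lt.2 hx hx'.1
  rw [measureReal_union hd measurableSet_Ioc]
  have : 0 < (gaussianReal 0 1).real (Set.Ioc a b) := by
    refine ENNReal.toReal_pos (gaussianReal_ne_zero_of_volume (by simp) ?_) (measure_ne_top _ _)
    simpa using hab
  linarith

theorem cdf_stdGaussian_pos (x : ℝ) : 0 < cdf (gaussianReal 0 1) x :=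
  (cdf_nonneg _ (x - 1)).trans_lt (strictMono_cdf_stdGaussian (by linarith))

theorem cdf_stdGaussian_lt_one (x : ℝ) : cdf (gaussianReal 0 1) x < 1 :=
  (strictMono_cdf_stdGaussian (show x < x + 1 by linarith)).trans_le (cdf_le_one _ _)

theorem gaussianReal_eq_map (x σ : ℝ) :
    gaussianReal x (Real.toNNReal (σ ^ 2)) =
      (gaussianReal 0 1).map (fun v => x + σ * v) := by
  have : (fun v : ℝ => x + σ * v) = (fun v => x + v) ∘ fun v => σ * v := rfl
  rw [this, ← Measure.map_map (by fun_prop) (by fun_prop), gaussianReal_map_const_mul,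
    gaussianReal_map_const_add]
  congr 1
  · simp
  · rw [mul_one]
    ext
    simp [sq_nonneg]

theorem toNNReal_sq_ne_zero {σ : ℝ} (hσ : 0 < σ) : Real.toNNReal (σ ^ 2) ≠ 0 := by
  simp [hσ.ne']

theorem gaussianPDFReal_ratio (x₁ x₂ θ : ℝ) {v : NNReal} (hv : v ≠ 0) :
    gaussianPDFReal x₂ v θ = gaussianPDFReal x₁ v θ *
      Real.exp (((x₂ - x₁) * θ) / v - (x₂ ^ 2 - x₁ ^ 2) / (2 * v)) := by
  have hv' : (v : ℝ) ≠ 0 := by exact_mod_cast hv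
  rw [gaussianPDFReal, gaussianPDFReal, mul_assoc _ (Real.exp _), ← Real.exp_add]
  congr 2
  field_simp
  ring

/-- Single crossing: if `f` changes sign once, from negative to positive, then so does its
Gaussian integral over a fixed set, as a function of the mean. -/
theorem setIntegral_gaussian_pos_of_nonneg {f : ℝ → ℝ} {c : ℝ} (hneg : ∀ θ < c, f θ < 0)
    (hpos : ∀ θ, c < θ → 0 < f θ) {v : NNReal} (hv : v ≠ 0) {s : Set ℝ} (hs : MeasurableSet s)
    (hs0 : volume s ≠ 0) (hf : ∀ x, Integrable f (gaussianReal x v)) {x₁ x₂ : ℝ}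
    (hx : x₁ < x₂) (h : 0 ≤ ∫ θ in s, f θ ∂gaussianReal x₁ v) :
    0 < ∫ θ in s, f θ ∂gaussianReal x₂ v := by
  have hv' : (0 : ℝ) < v := by
    have : (0 : NNReal) < v := pos_iff_ne_zero.2 hv
    exact_mod_cast this
  have key : ∀ x, ∫ θ in s, f θ ∂gaussianReal x v = ∫ θ in s, gaussianPDFReal x v θ * f θ := by
    intro x
    rw [← integral_indicator hs, integral_gaussianReal_eq_integral_smul hv, ← integral_indicator hs]
    congr 1
    ext θ
    by_cases hθ : θ ∈ s <;> simp [hθ]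
  have hint : ∀ x, Integrable (fun θ => gaussianPDFReal x v θ * f θ) (volume.restrict s) := by
    intro x
    have h1 := hf x
    rw [gaussianReal_of_var_ne_zero _ hv, integrable_withDensity_iff_integrable_smul'
      (measurable_gaussianPDF x v) (Eventually.of_forall fun _ => gaussianPDF_lt_top)] at h1
    refine (h1.congr (Eventually.of_forall fun θ => ?_)).restrict
    simp [toReal_gaussianPDF]
  -- `w` is the likelihood ratio of the two Gaussian laws; it increases because `x₁ < x₂`.
  set w : ℝ → ℝ := fun θ => Real.exp (((x₂ - x₁) * θ) / v - (x₂ ^ 2 - x₁ ^ 2) / (2 * v)) with hw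
  have hwmono : StrictMono w := by
    intro a b hab
    have : (x₂ - x₁) * a / v < (x₂ - x₁) * b / v := by
      have := sub_pos.2 hx
      gcongr
    simp only [hw]
    exact Real.exp_lt_exp.2 (by linarith)
  rw [key] at h ⊢
  -- Subtracting `w c` times the first integrand leaves the density times `f θ * (w θ - w c)`, whose
  -- factors have the same sign on either side of `c`.
  have hdiff : 0 < ∫ θ in s, (gaussianPDFReal x₂ v θ * f θ
      - w c * (gaussianPDFReal x₁ v θ * f θ)) := by
    have hpt : ∀ θ, gaussianPDFReal x₂ v θ * f θ - w c * (gaussianPDFReal x₁ v θ * f θ)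
        = gaussianPDFReal x₁ v θ * (f θ * (w θ - w c)) := by
      intro θ
      rw [gaussianPDFReal_ratio x₁ x₂ θ hv]
      simp only [hw]
      ring
    have hsgn : ∀ θ, θ ≠ c → 0 < gaussianPDFReal x₁ v θ * (f θ * (w θ - w c)) := by
      intro θ hθ
      refine mul_pos (gaussianPDFReal_pos _ _ _ hv) ?_
      rcases lt_or_gt_of_ne hθ with h' | h'
      · exact mul_pos_of_neg_of_neg (hneg θ h') (sub_neg.2 (hwmono h'))
      · exact mul_pos (hpos θ h') (sub_pos.2 (hwmono h'))
    refine (integral_pos_iff_support_of_nonneg (fun θ => ?_)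
      ((hint x₂).sub ((hint x₁).const_mul _))).2 ?_
    · change 0 ≤ gaussianPDFReal x₂ v θ * f θ - w c * (gaussianPDFReal x₁ v θ * f θ)
      rw [hpt]
      rcases eq_or_ne θ c with rfl | hθ
      · simp
      · exact (hsgn θ hθ).le
    · have hsub : s \ {c} ⊆ Function.support (fun θ => gaussianPDFReal x₂ v θ * f θ
          - w c * (gaussianPDFReal x₁ v θ * f θ)) ∩ s := by
        intro θ hθ
        refine ⟨?_, hθ.1⟩
        rw [Function.mem_support, hpt]
        exact (hsgn θ hθ.2).ne'
      rw [Measure.restrict_apply' hs]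
      refine lt_of_lt_of_le ?_ (measure_mono hsub)
      rw [measure_sdiff_null (by simp)]
      exact pos_iff_ne_zero.2 hs0
  rw [integral_sub (hint x₂) ((hint x₁).const_mul _), integral_const_mul] at hdiff
  have := mul_nonneg (Real.exp_pos _).le h (a := w c)
  linarith

/-! ### Gains from effort when the other followers use cutoff strategies -/

@[simp] theorem PhiExt_bot (σ θ : ℝ) : PhiExt σ ⊥ θ = 0 := by simp [PhiExt]

@[simp] theorem PhiExt_top (σ θ : ℝ) : PhiExt σ ⊤ θ = 1 := by simp [PhiExt]

@[simp] theorem PhiExt_coe (σ x θ : ℝ) :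
    PhiExt σ (x : EReal) θ = cdf (gaussianReal 0 1) ((x - θ) / σ) := by simp [PhiExt]

theorem PhiExt_nonneg (σ : ℝ) (x : EReal) (θ : ℝ) : 0 ≤ PhiExt σ x θ := by
  induction x
  · simp
  · simpa using cdf_nonneg _ _
  · simp

theorem PhiExt_le_one (σ : ℝ) (x : EReal) (θ : ℝ) : PhiExt σ x θ ≤ 1 := by
  induction x
  · simp
  · simpa using cdf_le_one _ _
  · simp

theorem continuous_PhiExt (σ : ℝ) (x : EReal) : Continuous (PhiExt σ x) := by
  induction x with
  | bot => exact continuous_const.congr fun θ => (PhiExt_bot σ θ).symm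
  | top => exact continuous_const.congr fun θ => (PhiExt_top σ θ).symm
  | coe x =>
    exact (continuous_cdf_stdGaussian.comp (by fun_prop : Continuous fun θ => (x - θ) / σ)).congr
      fun θ => (PhiExt_coe σ x θ).symm

theorem integrable_PhiExt (σ : ℝ) (x : EReal) (μ : Measure ℝ) [IsFiniteMeasure μ] :
    Integrable (PhiExt σ x) μ := by
  refine (integrable_const (1 : ℝ)).mono' (continuous_PhiExt σ x).aestronglyMeasurable
    (Eventually.of_forall fun θ => ?_)
  rw [Real.norm_of_nonneg (PhiExt_nonneg _ _ _)]
  exact PhiExt_le_one _ _ _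

theorem antitone_PhiExt {σ : ℝ} (hσ : 0 < σ) (x : EReal) : Antitone (PhiExt σ x) := by
  intro a b hab
  induction x with
  | bot => simp
  | top => simp
  | coe x =>
    rw [PhiExt_coe, PhiExt_coe]
    exact monotone_cdf _ (by gcongr)

theorem strictMono_PhiExt {σ : ℝ} (hσ : 0 < σ) (θ : ℝ) : StrictMono fun x => PhiExt σ x θ := by
  intro a b hab
  induction a with
  | top => simp at hab
  | bot =>
    induction b with
    | bot => simp at hab
    | top => simp
    | coe b => simpa using cdf_stdGaussian_pos _
  | coe a =>
    induction b with
    | bot => simp at hab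
    | top => simpa using cdf_stdGaussian_lt_one _
    | coe b =>
      have : a < b := by exact_mod_cast hab
      simp only [PhiExt_coe]
      exact strictMono_cdf_stdGaussian (by gcongr)

/-- The expected gain from effort in state `θ` after `h` when the other followers exert effort
exactly for signals above `x'`. -/
noncomputable def effortGain (n : ℕ) (σ : ℝ) (h : Act) (x' : EReal) (θ : ℝ) : ℝ :=
  θ - ((n : ℝ) - 1) / n * PhiExt σ x' θ - (1 - effort h) / n

/-- The unnormalized expectation of `effortGain` on the event that the leader, with threshold
`z`, chooses `h`. -/
noncomputable def totalGain (n : ℕ) (σ : ℝ) (h : Act) (x z : ℝ) (x' : EReal) : ℝ :=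
  ∫ θ in {θ | thresholdStrategy z θ = h}, effortGain n σ h x' θ
    ∂gaussianReal x (Real.toNNReal (σ ^ 2))

section

variable {n : ℕ} {σ : ℝ}

theorem others_share_pos (hn : 2 ≤ n) : 0 < ((n : ℝ) - 1) / n := by
  have : (2 : ℝ) ≤ n := by exact_mod_cast hn
  exact div_pos (by linarith) (by linarith)

theorem others_share_le_one (hn : 2 ≤ n) : ((n : ℝ) - 1) / n ≤ 1 := by
  have : (2 : ℝ) ≤ n := by exact_mod_cast hn
  rw [div_le_one (by linarith)]
  linarith

theorem effort_nonneg (h : Act) : 0 ≤ effort h := by cases h <;> simp [effort]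

theorem effort_le_one (h : Act) : effort h ≤ 1 := by cases h <;> simp [effort]

theorem effortGain_le (hn : 2 ≤ n) (h : Act) (x' : EReal) (θ : ℝ) :
    effortGain n σ h x' θ ≤ θ := by
  have h1 := mul_nonneg (others_share_pos hn).le (PhiExt_nonneg σ x' θ)
  have h2 : 0 ≤ (1 - effort h) / n :=
    div_nonneg (sub_nonneg.2 (effort_le_one h)) (Nat.cast_nonneg n)
  rw [effortGain]
  linarith

theorem le_effortGain (hn : 2 ≤ n) (h : Act) (x' : EReal) (θ : ℝ) :
    θ - 2 ≤ effortGain n σ h x' θ := by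
  have h1 := mul_le_mul (others_share_le_one hn) (PhiExt_le_one σ x' θ)
    (PhiExt_nonneg σ x' θ) zero_le_one
  have h2 : (1 - effort h) / n ≤ 1 := by
    have : (2 : ℝ) ≤ n := by exact_mod_cast hn
    rw [div_le_one (by linarith)]
    linarith [effort_nonneg h]
  rw [effortGain]
  linarith

theorem abs_effortGain_le (hn : 2 ≤ n) (h : Act) (x' : EReal) (θ : ℝ) :
    |effortGain n σ h x' θ| ≤ |θ| + 2 := by
  rw [abs_le]
  constructor
  · linarith [le_effortGain (σ := σ) hn h x' θ, neg_abs_le θ]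
  · linarith [effortGain_le (σ := σ) hn h x' θ, le_abs_self θ]

theorem continuous_effortGain (n : ℕ) (σ : ℝ) (h : Act) (x' : EReal) :
    Continuous (effortGain n σ h x') := by
  have := continuous_PhiExt σ x'
  unfold effortGain
  fun_prop

theorem strictMono_effortGain (hn : 2 ≤ n) (hσ : 0 < σ) (h : Act) (x' : EReal) :
    StrictMono (effortGain n σ h x') := by
  intro a b hab
  have := mul_le_mul_of_nonneg_left (antitone_PhiExt hσ x' hab.le) (others_share_pos hn).le
  rw [effortGain, effortGain]
  linarith

theorem effortGain_strictAnti (hn : 2 ≤ n) (hσ : 0 < σ) (h : Act) (θ : ℝ) :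
    StrictAnti fun x' => effortGain n σ h x' θ := by
  intro a b hab
  have := mul_lt_mul_of_pos_left (strictMono_PhiExt hσ θ hab) (others_share_pos hn)
  simp only [effortGain]
  simp only at this
  linarith

theorem exists_effortGain_eq_zero (hn : 2 ≤ n) (h : Act) (x' : EReal) :
    ∃ c, effortGain n σ h x' c = 0 := by
  have h1 := effortGain_le (σ := σ) hn h x' 0
  have h2 := le_effortGain (σ := σ) hn h x' 2
  obtain ⟨c, -, hc⟩ := intermediate_value_Icc (zero_le_two (α := ℝ))
    (continuous_effortGain n σ h x').continuousOn ⟨h1, by linarith⟩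
  exact ⟨c, hc⟩

theorem integrable_effortGain (hn : 2 ≤ n) (h : Act) (x' : EReal) (x : ℝ) (v : NNReal) :
    Integrable (effortGain n σ h x') (gaussianReal x v) := by
  refine ((integrable_id_gaussianReal x v).abs.add (integrable_const (2 : ℝ))).mono'
    (continuous_effortGain n σ h x').aestronglyMeasurable (Eventually.of_forall fun θ => ?_)
  exact abs_effortGain_le hn h x' θ

/-! ### Interim beliefs and the sign of a follower's expected gain. -/

theorem gaussianReal_thresholdStrategy_ne_zero (hσ : 0 < σ) (x z : ℝ) (h : Act) :
    gaussianReal x (Real.toNNReal (σ ^ 2)) {θ | thresholdStrategy z θ = h} ≠ 0 :=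
  gaussianReal_ne_zero_of_volume (toNNReal_sq_ne_zero hσ) (volume_thresholdStrategy_ne_zero z h)

theorem isProbabilityMeasure_interim (hσ : 0 < σ) (x z : ℝ) (h : Act) :
    IsProbabilityMeasure (interim σ x z h) :=
  cond_isProbabilityMeasure (gaussianReal_thresholdStrategy_ne_zero hσ x z h)

theorem integral_interim (σ x z : ℝ) (h : Act) (f : ℝ → ℝ) :
    ∫ θ, f θ ∂interim σ x z h =
      ((gaussianReal x (Real.toNNReal (σ ^ 2))).real {θ | thresholdStrategy z θ = h})⁻¹ *
        ∫ θ in {θ | thresholdStrategy z θ = h}, f θ ∂gaussianReal x (Real.toNNReal (σ ^ 2)) := by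
  rw [interim, ProbabilityTheory.cond, integral_smul_measure, smul_eq_mul, ENNReal.toReal_inv]
  rfl

theorem integrable_interim (hσ : 0 < σ) (x z : ℝ) (h : Act) {f : ℝ → ℝ}
    (hf : Integrable f (gaussianReal x (Real.toNNReal (σ ^ 2)))) :
    Integrable f (interim σ x z h) :=
  hf.restrict.smul_measure
    (ENNReal.inv_ne_top.2 (gaussianReal_thresholdStrategy_ne_zero hσ x z h))

theorem piF_eq_integral_effortGain (hn : 2 ≤ n) (hσ : 0 < σ) (h : Act) (x z : ℝ) (x' : EReal) :
    piF n σ h x z x' = ∫ θ, effortGain n σ h x' θ ∂interim σ x z h := by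
  have := isProbabilityMeasure_interim hσ x z h
  have hint : Integrable (fun θ => effortGain n σ h x' θ + (1 - effort h) / n)
      (interim σ x z h) :=
    (integrable_interim hσ x z h (integrable_effortGain hn h x' x _)).add (integrable_const _)
  have h0 : ∀ θ, θ - ((n : ℝ) - 1) / n * PhiExt σ x' θ
      = effortGain n σ h x' θ + (1 - effort h) / n := fun θ => by rw [effortGain]; ring
  simp_rw [piF, h0]
  rw [integral_add (integrable_interim hσ x z h (integrable_effortGain hn h x' x _))
    (integrable_const _)]
  simp

/-- Conditioning only divides by the positive mass of the event. All later arguments concern signs,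
so the normalization can be dropped. -/
theorem piF_eq_mul_totalGain (hn : 2 ≤ n) (hσ : 0 < σ) (h : Act) (x z : ℝ) :
    ∃ c, 0 < c ∧ ∀ x', piF n σ h x z x' = c * totalGain n σ h x z x' := by
  refine ⟨_, inv_pos.2 (ENNReal.toReal_pos (gaussianReal_thresholdStrategy_ne_zero hσ x z h)
    (measure_ne_top _ _)), fun x' => ?_⟩
  rw [piF_eq_integral_effortGain hn hσ, integral_interim]
  rfl

theorem piF_pos_iff (hn : 2 ≤ n) (hσ : 0 < σ) {h : Act} {x z : ℝ} {x' : EReal} :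
    0 < piF n σ h x z x' ↔ 0 < totalGain n σ h x z x' := by
  obtain ⟨c, hc, he⟩ := piF_eq_mul_totalGain hn hσ h x z
  rw [he, mul_pos_iff_of_pos_left hc]

theorem piF_nonpos_iff (hn : 2 ≤ n) (hσ : 0 < σ) {h : Act} {x z : ℝ} {x' : EReal} :
    piF n σ h x z x' ≤ 0 ↔ totalGain n σ h x z x' ≤ 0 := by
  rw [← not_lt, piF_pos_iff hn hσ, not_lt]

theorem piF_eq_zero_iff (hn : 2 ≤ n) (hσ : 0 < σ) {h : Act} {x z : ℝ} {x' : EReal} :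
    piF n σ h x z x' = 0 ↔ totalGain n σ h x z x' = 0 := by
  obtain ⟨c, hc, he⟩ := piF_eq_mul_totalGain hn hσ h x z
  rw [he, mul_eq_zero, or_iff_right hc.ne']

theorem totalGain_pos_of_lt (hn : 2 ≤ n) (hσ : 0 < σ) {h : Act} {x₁ x₂ z : ℝ} {x' : EReal}
    (hx : x₁ < x₂) (h0 : 0 ≤ totalGain n σ h x₁ z x') : 0 < totalGain n σ h x₂ z x' := by
  obtain ⟨c, hc⟩ := exists_effortGain_eq_zero (σ := σ) hn h x'
  have hm := strictMono_effortGain hn hσ h x'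
  exact setIntegral_gaussian_pos_of_nonneg (c := c) (fun θ hθ => hc ▸ hm hθ)
    (fun θ hθ => hc ▸ hm hθ) (toNNReal_sq_ne_zero hσ) (measurableSet_thresholdStrategy z h)
    (volume_thresholdStrategy_ne_zero z h) (fun x => integrable_effortGain hn h x' x _) hx h0

theorem setIntegral_lt_setIntegral {f g : ℝ → ℝ} {μ : Measure ℝ} {s : Set ℝ} (hs : MeasurableSet s)
    (hμ : μ s ≠ 0) (hf : Integrable f μ) (hg : Integrable g μ) (hlt : ∀ θ ∈ s, f θ < g θ) :
    ∫ θ in s, f θ ∂μ < ∫ θ in s, g θ ∂μ := by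
  rw [← sub_pos, ← integral_sub hg.restrict hf.restrict,
    setIntegral_pos_iff_support_of_nonneg_ae]
  · refine (pos_iff_ne_zero.2 hμ).trans_le (measure_mono fun θ hθ => ⟨?_, hθ⟩)
    exact (sub_pos.2 (hlt θ hθ)).ne'
  · filter_upwards [ae_restrict_mem hs] with θ hθ
    exact (sub_pos.2 (hlt θ hθ)).le
  · exact (hg.sub hf).integrableOn

theorem totalGain_strictAnti (hn : 2 ≤ n) (hσ : 0 < σ) (h : Act) (x z : ℝ) :
    StrictAnti (totalGain n σ h x z) := fun a b hab =>
  setIntegral_lt_setIntegral (measurableSet_thresholdStrategy z h)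
    (gaussianReal_thresholdStrategy_ne_zero hσ x z h) (integrable_effortGain hn h b x _)
    (integrable_effortGain hn h a x _) fun θ _ => effortGain_strictAnti hn hσ h θ hab

theorem totalGain_pos_of_forall (hn : 2 ≤ n) (hσ : 0 < σ) {h : Act} {x z : ℝ} {x' : EReal}
    (hp : ∀ θ, thresholdStrategy z θ = h → 0 < effortGain n σ h x' θ) :
    0 < totalGain n σ h x z x' := by
  have := setIntegral_lt_setIntegral (measurableSet_thresholdStrategy z h)
    (gaussianReal_thresholdStrategy_ne_zero hσ x z h) (integrable_zero _ _ _)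
    (integrable_effortGain hn h x' x _) hp
  simpa [totalGain] using this

theorem totalGain_neg_of_forall (hn : 2 ≤ n) (hσ : 0 < σ) {h : Act} {x z : ℝ} {x' : EReal}
    (hp : ∀ θ, thresholdStrategy z θ = h → effortGain n σ h x' θ < 0) :
    totalGain n σ h x z x' < 0 := by
  have := setIntegral_lt_setIntegral (measurableSet_thresholdStrategy z h)
    (gaussianReal_thresholdStrategy_ne_zero hσ x z h) (integrable_effortGain hn h x' x _)
    (integrable_zero _ _ _) hp
  simpa [totalGain] using this

/-- Raising the threshold discards the states in (z₀, z]. If the gain at `z` is nonnegative, only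
states with positive gain remain; otherwise the discarded part is nonpositive. The disjunction is
what the sign argument needs: the unnormalized integral itself is not monotone in `z`. -/
theorem totalGain_E_of_le (hn : 2 ≤ n) (hσ : 0 < σ) {x z₀ z : ℝ} {x' : EReal} (hz : z₀ ≤ z) :
    0 < totalGain n σ Act.E x z x' ∨
      totalGain n σ Act.E x z₀ x' ≤ totalGain n σ Act.E x z x' := by
  have hm := strictMono_effortGain hn hσ Act.E x'
  have hint := integrable_effortGain (σ := σ) hn Act.E x' x (Real.toNNReal (σ ^ 2))
  by_cases h0 : 0 ≤ effortGain n σ Act.E x' z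
  · left
    refine totalGain_pos_of_forall hn hσ fun θ hθ => h0.trans_lt (hm ?_)
    exact (Set.ext_iff.1 (setOf_thresholdStrategy_E z) θ).1 hθ
  · right
    have hd : Disjoint (Set.Ioc z₀ z) (Set.Ioi z) :=
      Set.disjoint_left.2 fun θ hθ hθ' => not_lt.2 hθ.2 hθ'
    rw [totalGain, totalGain, setOf_thresholdStrategy_E, setOf_thresholdStrategy_E,
      ← Set.Ioc_union_Ioi_eq_Ioi hz, setIntegral_union hd measurableSet_Ioi
        hint.integrableOn hint.integrableOn]
    have : ∫ θ in Set.Ioc z₀ z, effortGain n σ Act.E x' θ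
        ∂gaussianReal x (Real.toNNReal (σ ^ 2)) ≤ 0 :=
      setIntegral_nonpos measurableSet_Ioc fun θ hθ =>
        (hm.monotone hθ.2).trans (not_le.1 h0).le
    linarith

/-- Mirror image for a truncation from above: either all states up to `z` have negative gain, or the
states added in (z, z₁] contribute nonnegatively. -/
theorem totalGain_N_of_le (hn : 2 ≤ n) (hσ : 0 < σ) {x z z₁ : ℝ} {x' : EReal} (hz : z ≤ z₁) :
    totalGain n σ Act.N x z x' < 0 ∨
      totalGain n σ Act.N x z x' ≤ totalGain n σ Act.N x z₁ x' := by
  have hm := strictMono_effortGain hn hσ Act.N x'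
  have hint := integrable_effortGain (σ := σ) hn Act.N x' x (Real.toNNReal (σ ^ 2))
  rcases hz.eq_or_lt with rfl | hlt
  · exact Or.inr le_rfl
  by_cases h0 : effortGain n σ Act.N x' z < 0
  · left
    refine totalGain_neg_of_forall hn hσ fun θ hθ => (hm.monotone ?_).trans_lt h0
    exact (Set.ext_iff.1 (setOf_thresholdStrategy_N z) θ).1 hθ
  · right
    have hd : Disjoint (Set.Iic z) (Set.Ioc z z₁) :=
      Set.disjoint_left.2 fun θ hθ hθ' => not_lt.2 hθ hθ'.1
    rw [totalGain, totalGain, setOf_thresholdStrategy_N, setOf_thresholdStrategy_N,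
      ← Set.Iic_union_Ioc_eq_Iic hz, setIntegral_union hd measurableSet_Ioc
        hint.integrableOn hint.integrableOn]
    have : 0 ≤ ∫ θ in Set.Ioc z z₁, effortGain n σ Act.N x' θ
        ∂gaussianReal x (Real.toNNReal (σ ^ 2)) :=
      setIntegral_nonneg measurableSet_Ioc fun θ hθ =>
        (not_lt.1 h0).trans (hm.monotone hθ.1.le)
    linarith

theorem integral_Iic_add_integral_Ioi (hn : 2 ≤ n) (h : Act) (x z : ℝ) (x' : EReal) :
    ∫ θ in Set.Iic z, effortGain n σ h x' θ ∂gaussianReal x (Real.toNNReal (σ ^ 2)) +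
      ∫ θ in Set.Ioi z, effortGain n σ h x' θ ∂gaussianReal x (Real.toNNReal (σ ^ 2)) =
      ∫ θ, effortGain n σ h x' θ ∂gaussianReal x (Real.toNNReal (σ ^ 2)) := by
  rw [← Set.compl_Iic]
  exact integral_add_compl measurableSet_Iic (integrable_effortGain hn h x' x _)

theorem exists_totalGain_E_pos (hn : 2 ≤ n) (hσ : 0 < σ) (z : ℝ) (x' : EReal) :
    ∃ x, 0 < totalGain n σ Act.E x z x' := by
  set M := |effortGain n σ Act.E x' z| with hM
  -- The integral over all states is at least (M + 3) - 2, and the states up to `z` contribute at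
  -- most M, so at least 1 is left.
  refine ⟨M + 3, ?_⟩
  have hm := strictMono_effortGain hn hσ Act.E x'
  have hint := integrable_effortGain (σ := σ) hn Act.E x' (M + 3) (Real.toNNReal (σ ^ 2))
  have h1 := integral_Iic_add_integral_Ioi (σ := σ) hn Act.E (M + 3) z x'
  have h2 : ∫ θ, (θ - 2) ∂gaussianReal (M + 3) (Real.toNNReal (σ ^ 2)) ≤
      ∫ θ, effortGain n σ Act.E x' θ ∂gaussianReal (M + 3) (Real.toNNReal (σ ^ 2)) :=
    integral_mono ((integrable_id_gaussianReal _ _).sub (integrable_const _)) hint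
      fun θ => le_effortGain hn Act.E x' θ
  rw [integral_sub (integrable_id_gaussianReal _ _) (integrable_const _),
    integral_id_gaussianReal] at h2
  have h3 : ∫ θ in Set.Iic z, effortGain n σ Act.E x' θ
      ∂gaussianReal (M + 3) (Real.toNNReal (σ ^ 2)) ≤
      ∫ θ in Set.Iic z, M ∂gaussianReal (M + 3) (Real.toNNReal (σ ^ 2)) :=
    setIntegral_mono_on hint.integrableOn (integrable_const _) measurableSet_Iic
      fun θ hθ => (hm.monotone hθ).trans (le_abs_self _)
  have h4 : ∫ θ in Set.Iic z, M ∂gaussianReal (M + 3) (Real.toNNReal (σ ^ 2)) ≤ M := by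
    rw [setIntegral_const, smul_eq_mul]
    exact mul_le_of_le_one_left (abs_nonneg _) measureReal_le_one
  rw [totalGain, setOf_thresholdStrategy_E]
  simp at h2
  linarith

theorem exists_totalGain_N_neg (hn : 2 ≤ n) (hσ : 0 < σ) (z : ℝ) (x' : EReal) :
    ∃ x, totalGain n σ Act.N x z x' < 0 := by
  set M := |effortGain n σ Act.N x' z| with hM
  -- The integral over all states is at most -M - 1, and the states above `z` contribute at least
  -- -M.
  refine ⟨-M - 1, ?_⟩
  have hm := strictMono_effortGain hn hσ Act.N x'
  have hint := integrable_effortGain (σ := σ) hn Act.N x' (-M - 1) (Real.toNNReal (σ ^ 2))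
  have h1 := integral_Iic_add_integral_Ioi (σ := σ) hn Act.N (-M - 1) z x'
  have h2 : ∫ θ, effortGain n σ Act.N x' θ ∂gaussianReal (-M - 1) (Real.toNNReal (σ ^ 2)) ≤
      ∫ θ, θ ∂gaussianReal (-M - 1) (Real.toNNReal (σ ^ 2)) :=
    integral_mono hint (integrable_id_gaussianReal _ _) fun θ => effortGain_le hn Act.N x' θ
  rw [integral_id_gaussianReal] at h2
  have h3 : ∫ θ in Set.Ioi z, (-M) ∂gaussianReal (-M - 1) (Real.toNNReal (σ ^ 2)) ≤
      ∫ θ in Set.Ioi z, effortGain n σ Act.N x' θ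
      ∂gaussianReal (-M - 1) (Real.toNNReal (σ ^ 2)) :=
    setIntegral_mono_on (integrable_const _) hint.integrableOn measurableSet_Ioi
      fun θ hθ => (neg_abs_le _).trans (hm hθ).le
  have h4 : -M ≤ ∫ θ in Set.Ioi z, (-M) ∂gaussianReal (-M - 1) (Real.toNNReal (σ ^ 2)) := by
    rw [setIntegral_const, smul_eq_mul, mul_neg, neg_le_neg_iff]
    exact mul_le_of_le_one_left (abs_nonneg _) measureReal_le_one
  rw [totalGain, setOf_thresholdStrategy_N]
  linarith

/-- The total gain after a change of variables to standard Gaussian noise. -/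
theorem totalGain_eq (hσ : 0 < σ) (h : Act) (x z : ℝ) (x' : EReal) :
    totalGain n σ h x z x' = ∫ v in {v | thresholdStrategy ((z - x) / σ) v = h},
      effortGain n σ h x' (x + σ * v) ∂gaussianReal 0 1 := by
  rw [totalGain, gaussianReal_eq_map, setIntegral_map (measurableSet_thresholdStrategy z h)
    (continuous_effortGain n σ h x').aestronglyMeasurable (by fun_prop)]
  congr 2
  ext v
  simp only [Set.mem_preimage, Set.mem_ofPred_eq, thresholdStrategy]
  have : z < x + σ * v ↔ (z - x) / σ < v := by
    rw [div_lt_iff₀ hσ]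
    constructor <;> intro h <;> linarith
  simp only [this]

theorem continuous_totalGain (hn : 2 ≤ n) (hσ : 0 < σ) (h : Act) (z : ℝ) (x' : EReal) :
    Continuous fun x => totalGain n σ h x z x' := by
  simp_rw [totalGain_eq hσ]
  refine continuous_integral_thresholdStrategy (by fun_prop)
    (f := fun x v => effortGain n σ h x' (x + σ * v)) (fun v => ?_) (fun x => ?_) (fun x₀ => ?_) h
  · exact (continuous_effortGain n σ h x').comp (by fun_prop)
  · exact ((continuous_effortGain n σ h x').comp (by fun_prop)).measurable
  · refine ⟨|x₀| + 3 + σ, ?_⟩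
    have h1 : ∀ᶠ x : ℝ in 𝓝 x₀, |x| < |x₀| + 1 :=
      continuous_abs.continuousAt.eventually (gt_mem_nhds (by linarith))
    filter_upwards [h1] with x hx v
    have h2 := abs_effortGain_le (σ := σ) hn h x' (x + σ * v)
    have h3 := abs_add_le x (σ * v)
    rw [abs_mul, abs_of_pos hσ] at h3
    have h4 : 0 ≤ (|x₀| + 3) * |v| := by positivity
    linarith

/-- Joint continuity in signal and cutoff, for passing to the limit in the recursion of the upper
bounds after effort. -/
theorem continuous_totalGain_E_diag (hn : 2 ≤ n) (hσ : 0 < σ) (z : ℝ) :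
    Continuous fun p : ℝ × ℝ => totalGain n σ Act.E p.1 z (p.2 : EReal) := by
  simp_rw [totalGain_eq hσ]
  refine continuous_integral_thresholdStrategy (a := fun p : ℝ × ℝ => (z - p.1) / σ) (by fun_prop)
    (f := fun p v => effortGain n σ Act.E (p.2 : EReal) (p.1 + σ * v))
    (fun v => ?_) (fun x => ?_) (fun x₀ => ?_) Act.E
  · simp only [effortGain, PhiExt_coe]
    have := continuous_cdf_stdGaussian
    fun_prop
  · exact ((continuous_effortGain n σ Act.E _).comp (by fun_prop)).measurable
  · refine ⟨|x₀.1| + 3 + σ, ?_⟩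
    have h1 : ∀ᶠ x : ℝ × ℝ in 𝓝 x₀, |x.1| < |x₀.1| + 1 :=
      (continuous_abs.comp continuous_fst).continuousAt.eventually (gt_mem_nhds (by simp))
    filter_upwards [h1] with x hx v
    have h2 := abs_effortGain_le (σ := σ) hn Act.E (x.2 : EReal) (x.1 + σ * v)
    have h3 := abs_add_le x.1 (σ * v)
    rw [abs_mul, abs_of_pos hσ] at h3
    have h4 : 0 ≤ (|x₀.1| + 3) * |v| := by positivity
    linarith

/-! ### Best-response thresholds -/

/-- By the intermediate value theorem a gain without zeros has one sign, which is known at some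
large signal after effort and at some low signal after no effort. This makes the conventions -∞ and
∞ in `brF` the right ones. -/
theorem totalGain_no_zero (hn : 2 ≤ n) (hσ : 0 < σ) {h : Act} {z : ℝ} {x' : EReal}
    (H : ¬∃ x : ℝ, totalGain n σ h x z x' = 0) (x : ℝ) :
    (h = Act.E → 0 < totalGain n σ h x z x') ∧ (h = Act.N → totalGain n σ h x z x' < 0) := by
  have hc := continuous_totalGain hn hσ h z x'
  constructor
  · rintro rfl
    obtain ⟨y, hy⟩ := exists_totalGain_E_pos hn hσ z x'
    by_contra hx
    exact H (mem_range_of_exists_le_of_exists_ge hc ⟨x, not_lt.1 hx⟩ ⟨y, hy.le⟩)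
  · rintro rfl
    obtain ⟨y, hy⟩ := exists_totalGain_N_neg hn hσ z x'
    by_contra hx
    exact H (mem_range_of_exists_le_of_exists_ge hc ⟨y, hy.le⟩ ⟨x, not_lt.1 hx⟩)

/-- Single crossing in the signal turns comparisons with the chosen zero into signs of the gain.
Together with the weak version below, this replaces the definition of `brF` from here on. -/
theorem coe_lt_brF_iff (hn : 2 ≤ n) (hσ : 0 < σ) {h : Act} {x z : ℝ} {x' : EReal} :
    (x : EReal) < brF n σ h z x' ↔ totalGain n σ h x z x' < 0 := by
  rw [brF]
  split_ifs with H hh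
  · have hr := (piF_eq_zero_iff hn hσ).1 H.choose_spec
    rw [EReal.coe_lt_coe_iff]
    constructor
    · intro hx
      by_contra h0
      exact (totalGain_pos_of_lt hn hσ hx (not_lt.1 h0)).ne' hr
    · intro hx
      by_contra h0
      rcases (not_lt.1 h0).eq_or_lt with h1 | h1
      · exact hx.ne (h1 ▸ hr)
      · exact hx.not_gt (totalGain_pos_of_lt hn hσ h1 hr.ge)
  · simp_rw [piF_eq_zero_iff hn hσ] at H
    simpa using ((totalGain_no_zero hn hσ H x).1 hh).le
  · simp_rw [piF_eq_zero_iff hn hσ] at H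
    have hN : h = Act.N := by cases h <;> simp_all
    simpa using (totalGain_no_zero hn hσ H x).2 hN

theorem coe_le_brF_iff (hn : 2 ≤ n) (hσ : 0 < σ) {h : Act} {x z : ℝ} {x' : EReal} :
    (x : EReal) ≤ brF n σ h z x' ↔ totalGain n σ h x z x' ≤ 0 := by
  rw [brF]
  split_ifs with H hh
  · have hr := (piF_eq_zero_iff hn hσ).1 H.choose_spec
    rw [EReal.coe_le_coe_iff]
    constructor
    · intro hx
      by_contra h0
      rcases hx.eq_or_lt with h1 | h1
      · exact h0 (h1 ▸ hr).le
      · exact (totalGain_pos_of_lt hn hσ h1 (not_le.1 h0).le).ne' hr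
    · intro hx
      by_contra h0
      exact hx.not_gt (totalGain_pos_of_lt hn hσ (not_le.1 h0) hr.ge)
  · simp_rw [piF_eq_zero_iff hn hσ] at H
    simpa using (totalGain_no_zero hn hσ H x).1 hh
  · simp_rw [piF_eq_zero_iff hn hσ] at H
    have hN : h = Act.N := by cases h <;> simp_all
    simpa using ((totalGain_no_zero hn hσ H x).2 hN).le

theorem brF_E_ne_top (n : ℕ) (σ z : ℝ) (x' : EReal) : brF n σ Act.E z x' ≠ ⊤ := by
  rw [brF, if_pos rfl]
  split_ifs <;> simp

theorem brF_N_ne_bot (n : ℕ) (σ z : ℝ) (x' : EReal) : brF n σ Act.N z x' ≠ ⊥ := by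
  rw [brF]
  split_ifs <;> simp_all

theorem monotone_brF (hn : 2 ≤ n) (hσ : 0 < σ) (h : Act) (z : ℝ) :
    Monotone (brF n σ h z) := by
  intro a b hab
  refine EReal.le_of_forall_lt_iff_le.1 fun x hx => ?_
  by_contra hlt
  have h1 := (coe_lt_brF_iff hn hσ).1 (not_le.1 hlt)
  exact hx.not_gt ((coe_lt_brF_iff hn hσ).2
    (((totalGain_strictAnti hn hσ h x z).antitone hab).trans_lt h1))

/-! ### The leader's best-response threshold. -/

theorem piL_strictMono (hσ : 0 < σ) (x' : EReal) : StrictMono fun θ => piL σ θ x' := by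
  intro a b hab
  have := antitone_PhiExt hσ x' hab.le
  simp only [piL]
  linarith

theorem piL_brL (σ : ℝ) (x' : EReal) : piL σ (brL σ x') x' = 0 := by
  refine Classical.epsilon_spec (p := fun θ : ℝ => piL σ θ x' = 0) ?_
  have hc : Continuous fun θ => piL σ θ x' := continuous_id.sub (continuous_PhiExt σ x')
  refine mem_range_of_exists_le_of_exists_ge hc ⟨0, ?_⟩ ⟨1, ?_⟩
  · simpa [piL] using PhiExt_nonneg σ x' 0
  · simpa [piL] using PhiExt_le_one σ x' 1

theorem le_brL_iff (hσ : 0 < σ) {θ : ℝ} {x' : EReal} : θ ≤ brL σ x' ↔ piL σ θ x' ≤ 0 := by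
  rw [← piL_brL σ x']
  exact ((piL_strictMono hσ x').le_iff_le (a := θ) (b := brL σ x')).symm

theorem brL_eq_PhiExt (σ : ℝ) (x' : EReal) : brL σ x' = PhiExt σ x' (brL σ x') :=
  sub_eq_zero.1 (piL_brL σ x')

theorem brL_nonneg (σ : ℝ) (x' : EReal) : 0 ≤ brL σ x' := by
  rw [brL_eq_PhiExt]; exact PhiExt_nonneg _ _ _

@[simp] theorem brL_bot (σ : ℝ) : brL σ ⊥ = 0 := by
  rw [brL_eq_PhiExt]; simp

theorem monotone_brL (hσ : 0 < σ) : Monotone (brL σ) := by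
  intro a b hab
  rw [le_brL_iff hσ, ← piL_brL σ a]
  exact sub_le_sub_left ((strictMono_PhiExt hσ _).monotone hab) _

end

/-! ### Cutoff strategies -/

open Classical in
/-- `1` for signals above the cutoff `x'`, `0` for the others. -/
noncomputable def above (x' : EReal) (y : ℝ) : ℝ := if x' < (y : EReal) then 1 else 0

open Classical in
/-- The strategy of a follower with signal `y` who, after `h`, exerts effort iff `x' h < y`. -/
noncomputable def cutoffStrategy (x' : Act → EReal) (y : ℝ) : Strategy :=
  fun h => if x' h < (y : EReal) then Act.E else Act.N

theorem effort_cutoffStrategy (x' : Act → EReal) (y : ℝ) (h : Act) :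
    effort (cutoffStrategy x' y h) = above (x' h) y := by
  rw [effort, cutoffStrategy, above]
  split_ifs <;> simp_all

theorem measurableSet_above (x' : EReal) : MeasurableSet {y : ℝ | x' < (y : EReal)} :=
  measurableSet_lt measurable_const measurable_coe_real_ereal

theorem measurable_above (x' : EReal) : Measurable (above x') :=
  Measurable.ite (measurableSet_above x') measurable_const measurable_const

theorem measurable_cutoffStrategy (x' : Act → EReal) : Measurable (cutoffStrategy x') :=
  measurable_pi_iff.2 fun h =>
    Measurable.ite (measurableSet_above (x' h)) measurable_const measurable_const

theorem measurable_effort : Measurable effort := measurable_from_top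

theorem above_nonneg (x' : EReal) (y : ℝ) : 0 ≤ above x' y := by
  rw [above]; split_ifs <;> simp

theorem above_le_one (x' : EReal) (y : ℝ) : above x' y ≤ 1 := by
  rw [above]; split_ifs <;> simp

section

variable {n : ℕ} {σ : ℝ}

theorem integral_above_gaussian (hσ : 0 < σ) (x' : EReal) (θ : ℝ) :
    ∫ v, above x' (θ + σ * v) ∂gaussianReal 0 1 = 1 - PhiExt σ x' θ := by
  induction x' with
  | bot =>
    have : ∀ v, above ⊥ (θ + σ * v) = 1 := fun v => if_pos (EReal.bot_lt_coe _)
    simp [this]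
  | top => simp [above]
  | coe x' =>
    have : (fun v => above (x' : EReal) (θ + σ * v)) =
        (Set.Iic ((x' - θ) / σ))ᶜ.indicator fun _ => 1 := by
      ext v
      have : x' < θ + σ * v ↔ (x' - θ) / σ < v := by
        rw [div_lt_iff₀ hσ]
        constructor <;> intro h <;> linarith
      simp only [above, EReal.coe_lt_coe_iff, this, Set.indicator, Set.mem_compl_iff,
        Set.mem_Iic, not_le]
    rw [this, integral_indicator measurableSet_Iic.compl, setIntegral_const,
      probReal_compl_eq_one_sub measurableSet_Iic, PhiExt_coe, cdf_eq_real]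
    simp

theorem integral_above_noise (hσ : 0 < σ) {ι : Type} [Fintype ι] (k : ι) (x' : EReal) (θ : ℝ) :
    ∫ ε, above x' (θ + σ * ε k) ∂noise ι = 1 - PhiExt σ x' θ := by
  rw [← integral_above_gaussian hσ]
  have hmp : MeasurePreserving (Function.eval k) (noise ι) (gaussianReal 0 1) :=
    measurePreserving_eval (fun _ : ι => gaussianReal 0 1) k
  have hm : Measurable fun v => above x' (θ + σ * v) :=
    (measurable_above x').comp (by fun_prop : Measurable fun v => θ + σ * v)
  rw [← hmp.map_eq, integral_map hmp.measurable.aemeasurable hm.aestronglyMeasurable]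

instance {ι : Type} [Fintype ι] : IsProbabilityMeasure (noise ι) := by
  unfold noise; infer_instance

theorem integrable_effort {α : Type*} [MeasurableSpace α] (μ : Measure α) [IsFiniteMeasure μ]
    {g : α → Act} (hg : Measurable g) : Integrable (fun q => effort (g q)) μ := by
  refine (integrable_const (1 : ℝ)).mono' (measurable_effort.comp hg).aestronglyMeasurable
    (Eventually.of_forall fun q => ?_)
  rw [Real.norm_of_nonneg (effort_nonneg _)]
  exact effort_le_one _

theorem integrable_above {α : Type*} [MeasurableSpace α] (μ : Measure α) [IsFiniteMeasure μ]
    (x' : EReal) {g : α → ℝ} (hg : Measurable g) : Integrable (fun q => above x' (g q)) μ := by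
  refine (integrable_const (1 : ℝ)).mono' ((measurable_above x').comp hg).aestronglyMeasurable
    (Eventually.of_forall fun q => ?_)
  rw [Real.norm_of_nonneg (above_nonneg _ _)]
  exact above_le_one _ _

/-- Linearity of expectation: correlation between state, signals and strategies under a belief has
no effect on expected payoffs beyond the individual expectations. -/
theorem integral_add_average {α ι : Type*} [MeasurableSpace α] [Fintype ι] (μ : Measure α)
    [IsProbabilityMeasure μ] {f : α → ℝ} (hf : Integrable f μ) {g : ι → α → Act}
    (hg : ∀ k, Measurable (g k)) (c N : ℝ) :
    ∫ q, (f q + (c + ∑ k, effort (g k q)) / N - 1) ∂μ =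
      ∫ q, f q ∂μ + (c + ∑ k, ∫ q, effort (g k q) ∂μ) / N - 1 := by
  have hi : ∀ k ∈ Finset.univ, Integrable (fun q => effort (g k q)) μ :=
    fun k _ => integrable_effort μ (hg k)
  have hs : Integrable (fun q => (c + ∑ k, effort (g k q)) / N) μ :=
    ((integrable_const c).add (integrable_finsetSum _ hi)).div_const N
  have hfs : Integrable (fun q => f q + (c + ∑ k, effort (g k q)) / N) μ := hf.add hs
  rw [integral_sub hfs (integrable_const _), integral_add hf hs, integral_div,
    integral_add (integrable_const c) (integrable_finsetSum _ hi), integral_finsetSum _ hi]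
  simp

/-! ### Sets of type-action pairs given by bounds -/

/-- The leader's type-action pairs that survive with bounds `lo` and `hi`. -/
def leaderSet (lo hi : EReal) : Set (ℝ × Act) :=
  {p | (p.2 = Act.E → lo < (p.1 : EReal)) ∧ (p.2 = Act.N → (p.1 : EReal) ≤ hi)}

/-- A follower's type-strategy pairs that survive with upper bound `xE` after `E` and lower bound
`xN` after `N`. -/
def followerSet (xE xN : EReal) : Set (ℝ × Strategy) :=
  {q | (q.2 Act.E = Act.N → (q.1 : EReal) ≤ xE) ∧ (q.2 Act.N = Act.E → xN < (q.1 : EReal))}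

theorem measurableSet_leaderSet (lo hi : EReal) : MeasurableSet (leaderSet lo hi) := by
  have hE : MeasurableSet {p : ℝ × Act | p.2 = Act.E} :=
    measurable_snd (show MeasurableSet {Act.E} from trivial)
  have hN : MeasurableSet {p : ℝ × Act | p.2 = Act.N} :=
    measurable_snd (show MeasurableSet {Act.N} from trivial)
  have h1 : MeasurableSet {p : ℝ × Act | lo < (p.1 : EReal)} :=
    measurableSet_lt measurable_const (measurable_coe_real_ereal.comp measurable_fst)
  have h2 : MeasurableSet {p : ℝ × Act | (p.1 : EReal) ≤ hi} :=
    measurableSet_le (measurable_coe_real_ereal.comp measurable_fst) measurable_const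
  exact (hE.imp h1).inter (hN.imp h2)

theorem measurableSet_followerSet (xE xN : EReal) : MeasurableSet (followerSet xE xN) := by
  have hm : ∀ h : Act, Measurable fun q : ℝ × Strategy => q.2 h := fun h =>
    (measurable_pi_apply h).comp measurable_snd
  have hE : MeasurableSet {p : ℝ × Strategy | p.2 Act.E = Act.N} :=
    hm Act.E (show MeasurableSet {Act.N} from trivial)
  have hN : MeasurableSet {p : ℝ × Strategy | p.2 Act.N = Act.E} :=
    hm Act.N (show MeasurableSet {Act.E} from trivial)
  have h1 : MeasurableSet {p : ℝ × Strategy | (p.1 : EReal) ≤ xE} :=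
    measurableSet_le (measurable_coe_real_ereal.comp measurable_fst) measurable_const
  have h2 : MeasurableSet {p : ℝ × Strategy | xN < (p.1 : EReal)} :=
    measurableSet_lt measurable_const (measurable_coe_real_ereal.comp measurable_fst)
  exact (hE.imp h1).inter (hN.imp h2)

theorem mem_followerSet_cutoffStrategy {x' : Act → EReal} {xE xN : EReal} (hE : x' Act.E ≤ xE)
    (hN : xN ≤ x' Act.N) (y : ℝ) : (y, cutoffStrategy x' y) ∈ followerSet xE xN := by
  constructor
  · intro h
    refine le_trans (not_lt.1 fun hlt => ?_) hE
    simp [cutoffStrategy, hlt] at h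
  · intro h
    refine hN.trans_lt (not_le.1 fun hle => ?_)
    simp [cutoffStrategy, hle.not_gt] at h

/-- The least effort compatible with the surviving set after effort is that of the cutoff strategy
at the upper bound; its counterpart below gives the most effort after no effort. -/
theorem above_le_effort_of_mem {xE xN : EReal} {q : ℝ × Strategy} (hq : q ∈ followerSet xE xN) :
    above xE q.1 ≤ effort (q.2 Act.E) := by
  rw [above]
  split_ifs with h
  · cases hs : q.2 Act.E
    · simp [effort]
    · exact absurd (hq.1 hs) (not_le.2 h)
  · exact effort_nonneg _

theorem effort_le_above_of_mem {xE xN : EReal} {q : ℝ × Strategy} (hq : q ∈ followerSet xE xN) :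
    effort (q.2 Act.N) ≤ above xN q.1 := by
  rw [above]
  split_ifs with h
  · exact effort_le_one _
  · cases hs : q.2 Act.N
    · exact absurd (hq.2 hs) h
    · simp [effort]

/-! ### The leader's elimination step -/

theorem measurable_signals {ι : Type} (k : ι) :
    Measurable fun q : ι → ℝ × Strategy => (q k).1 := by fun_prop

theorem measurable_actions {ι : Type} (k : ι) (h : Act) :
    Measurable fun q : ι → ℝ × Strategy => (q k).2 h := by fun_prop

theorem integral_above_leaderBelief (hσ : 0 < σ) {θ : ℝ} {μ : Measure (Fin n → ℝ × Strategy)}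
    (hμ : LeaderBelief n σ θ μ) (k : Fin n) (x' : EReal) :
    ∫ q, above x' (q k).1 ∂μ = 1 - PhiExt σ x' θ := by
  have hm : Measurable fun p : Fin n → ℝ => above x' (p k) :=
    (measurable_above x').comp (measurable_pi_apply k)
  have hsig : Measurable fun (p : Fin n → ℝ × Strategy) k => (p k).1 := by fun_prop
  have hnoise : Measurable fun (ε : Fin n → ℝ) k => θ + σ * ε k := by fun_prop
  have h1 := integral_map (μ := μ) hsig.aemeasurable hm.aestronglyMeasurable
  rw [← h1, hμ.2, integral_map hnoise.aemeasurable hm.aestronglyMeasurable]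
  exact integral_above_noise hσ k x' θ

theorem integral_payoff_leader (θ : ℝ) (μ : Measure (Fin n → ℝ × Strategy))
    [IsProbabilityMeasure μ] :
    ∫ q, payoff θ (leaderAggregate n fun k => (q k).2) ∂μ =
      θ + (∑ k, ∫ q, effort ((q k).2 Act.E) ∂μ) / n - 1 := by
  have := integral_add_average μ (integrable_const θ)
    (fun k : Fin n => measurable_actions k Act.E) 0 n
  simpa [payoff, leaderAggregate] using this

theorem exists_leaderBelief (hn : 2 ≤ n) (hσ : 0 < σ) (θ : ℝ) {x' : Act → EReal} {xE xN : EReal}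
    (hE : x' Act.E ≤ xE) (hN : xN ≤ x' Act.N) :
    ∃ μ : Measure (Fin n → ℝ × Strategy), LeaderBelief n σ θ μ ∧
      (∀ᵐ q ∂μ, ∀ k, q k ∈ followerSet xE xN) ∧
      ∫ q, payoff θ (leaderAggregate n fun k => (q k).2) ∂μ = piL σ θ (x' Act.E) := by
  have hc := measurable_cutoffStrategy x'
  have hm : Measurable fun (ε : Fin n → ℝ) k =>
      (θ + σ * ε k, cutoffStrategy x' (θ + σ * ε k)) := by fun_prop
  set μ := (noise (Fin n)).map fun ε k => (θ + σ * ε k, cutoffStrategy x' (θ + σ * ε k)) with hμ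
  have hprob : IsProbabilityMeasure μ := Measure.isProbabilityMeasure_map hm.aemeasurable
  have hbel : LeaderBelief n σ θ μ := by
    refine ⟨hprob, ?_⟩
    rw [hμ, Measure.map_map (by fun_prop) hm]
    rfl
  refine ⟨μ, hbel, ?_, ?_⟩
  · have hms : MeasurableSet {q : Fin n → ℝ × Strategy | ∀ k, q k ∈ followerSet xE xN} := by
      have : {q : Fin n → ℝ × Strategy | ∀ k, q k ∈ followerSet xE xN} =
          ⋂ k, (fun q => q k) ⁻¹' followerSet xE xN := by ext; simp
      rw [this]
      exact MeasurableSet.iInter fun k => measurable_pi_apply k (measurableSet_followerSet xE xN)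
    rw [hμ, ae_map_iff hm.aemeasurable hms]
    exact Eventually.of_forall fun ε k => mem_followerSet_cutoffStrategy hE hN _
  · have h1 : ∀ k, ∫ q, effort ((q k).2 Act.E) ∂μ = 1 - PhiExt σ (x' Act.E) θ := by
      intro k
      have hme : Measurable fun q : Fin n → ℝ × Strategy => effort ((q k).2 Act.E) :=
        measurable_effort.comp (measurable_actions k Act.E)
      rw [hμ, integral_map hm.aemeasurable hme.aestronglyMeasurable, ← integral_above_noise hσ k]
      simp_rw [effort_cutoffStrategy]
    rw [integral_payoff_leader]
    simp_rw [h1]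
    have : (n : ℝ) ≠ 0 := by positivity
    simp [piL]
    field_simp
    ring

/-- The best belief is that all followers imitate effort, giving payoff θ; the worst is that they
use the cutoff `xE`, giving `piL σ θ xE`. Both are supported on the followers' surviving sets. -/
theorem leaderStep_eq (hn : 2 ≤ n) (hσ : 0 < σ) (RL : Set (ℝ × Act)) (xE xN : EReal) :
    leaderStep n σ RL (fun _ => followerSet xE xN) = RL ∩ leaderSet 0 (brL σ xE) := by
  have hn0 : (0 : ℝ) < n := by positivity
  ext ⟨θ, a⟩
  constructor
  · rintro ⟨hRL, μ, hμ, hae, hopt⟩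
    have := hμ.1
    refine ⟨hRL, ?_, ?_⟩
    · rintro rfl
      have h0 := hopt.1 rfl
      have hle : ∑ k, ∫ q, effort ((q k).2 Act.E) ∂μ ≤ ∑ _k : Fin n, (1 : ℝ) := by
        refine Finset.sum_le_sum fun k _ => ?_
        have := integral_mono (integrable_effort μ (measurable_actions k Act.E))
          (integrable_const (1 : ℝ)) fun q => effort_le_one ((q k).2 Act.E)
        simpa using this
      rw [integral_payoff_leader] at h0
      have : (∑ k, ∫ q, effort ((q k).2 Act.E) ∂μ) / n ≤ 1 := by
        rw [div_le_one hn0]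
        simpa using hle
      have hθ : (0 : ℝ) < θ := by
        simp only at h0
        linarith
      exact_mod_cast hθ
    · intro ha
      simp only at ha
      subst ha
      have h0 : ¬ 0 < ∫ q, payoff θ (leaderAggregate n fun k => (q k).2) ∂μ :=
        fun h => by simpa using hopt.2 h
      have hge : ∑ _k : Fin n, (1 - PhiExt σ xE θ) ≤ ∑ k, ∫ q, effort ((q k).2 Act.E) ∂μ := by
        refine Finset.sum_le_sum fun k _ => ?_
        rw [← integral_above_leaderBelief hσ hμ k xE]
        refine integral_mono_ae (integrable_above μ xE (measurable_signals k))
          (integrable_effort μ (measurable_actions k Act.E)) ?_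
        filter_upwards [hae] with q hq
        exact above_le_effort_of_mem (hq k)
      rw [integral_payoff_leader] at h0
      have : 1 - PhiExt σ xE θ ≤ (∑ k, ∫ q, effort ((q k).2 Act.E) ∂μ) / n := by
        rw [le_div_iff₀ hn0]
        simp at hge
        linarith
      rw [EReal.coe_le_coe_iff, le_brL_iff hσ, piL]
      linarith
  · rintro ⟨hRL, h1, h2⟩
    refine ⟨hRL, ?_⟩
    cases a
    · obtain ⟨μ, hμ, hae, hv⟩ := exists_leaderBelief hn hσ θ
        (x' := fun h => if h = Act.E then ⊥ else ⊤) (xE := xE) (xN := xN) (by simp) (by simp)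
      refine ⟨μ, hμ, hae, ?_⟩
      have : 0 < θ := by exact_mod_cast h1 rfl
      simp only [Optimal]
      rw [hv]
      simpa [piL] using this
    · obtain ⟨μ, hμ, hae, hv⟩ := exists_leaderBelief hn hσ θ
        (x' := fun h => if h = Act.E then xE else ⊤) (xE := xE) (xN := xN) (by simp) (by simp)
      refine ⟨μ, hμ, hae, ?_⟩
      have := (le_brL_iff hσ).1 (EReal.coe_le_coe_iff.1 (h2 rfl))
      simp only [Optimal]
      rw [hv]
      simpa using this

end

/-! ### The followers' elimination step -/

section

variable {n : ℕ} {σ : ℝ}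

/-- The law of the leader's type-action pair and of the other followers' signals for a follower
with signal `x` after `h` who believes in the leader's threshold `z`. -/
noncomputable def signalLaw (n : ℕ) (σ : ℝ) (j : Fin n) (x z : ℝ) (h : Act) :
    Measure ((ℝ × Act) × (Others n j → ℝ)) :=
  ((interim σ x z h).prod (noise (Others n j))).map
    (fun q => ((q.1, h), fun k => q.1 + σ * q.2 k))

theorem measurable_signalLaw_map (σ : ℝ) (j : Fin n) (h : Act) :
    Measurable fun q : ℝ × (Others n j → ℝ) =>
      (((q.1, h), fun k => q.1 + σ * q.2 k) : (ℝ × Act) × (Others n j → ℝ)) := by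
  fun_prop

theorem measurable_typesOf (j : Fin n) :
    Measurable fun p : (ℝ × Act) × (Others n j → ℝ × Strategy) =>
      ((p.1, fun k => (p.2 k).1) : (ℝ × Act) × (Others n j → ℝ)) := by
  fun_prop

theorem measurable_otherActions (j : Fin n) (h : Act) (k : Others n j) :
    Measurable fun q : (ℝ × Act) × (Others n j → ℝ × Strategy) => (q.2 k).2 h := by
  fun_prop

theorem map_fst_signalLaw (hσ : 0 < σ) (j : Fin n) (x z : ℝ) (h : Act) :
    (signalLaw n σ j x z h).map Prod.fst = (interim σ x z h).map fun θ => (θ, h) := by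
  have := isProbabilityMeasure_interim hσ x z h
  have h1 : (interim σ x z h) = ((interim σ x z h).prod (noise (Others n j))).map Prod.fst := by
    simp
  rw [signalLaw, Measure.map_map measurable_fst (measurable_signalLaw_map σ j h)]
  conv_rhs => rw [h1]
  rw [Measure.map_map (by fun_prop) measurable_fst]
  rfl

theorem integral_above_signalLaw (hσ : 0 < σ) (j : Fin n) (x z : ℝ) (h : Act) (x' : EReal)
    (k : Others n j) : ∫ p, above x' (p.2 k) ∂signalLaw n σ j x z h =
      1 - ∫ θ, PhiExt σ x' θ ∂interim σ x z h := by
  have := isProbabilityMeasure_interim hσ x z h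
  have hm : Measurable fun p : (ℝ × Act) × (Others n j → ℝ) => above x' (p.2 k) :=
    (measurable_above x').comp (by fun_prop : Measurable
      fun p : (ℝ × Act) × (Others n j → ℝ) => p.2 k)
  have hm' : Measurable fun q : ℝ × (Others n j → ℝ) => q.1 + σ * q.2 k := by fun_prop
  rw [signalLaw, integral_map (measurable_signalLaw_map σ j h).aemeasurable
    hm.aestronglyMeasurable, integral_prod _ (integrable_above _ x' hm')]
  simp only
  simp_rw [integral_above_noise hσ]
  have hP := integrable_PhiExt σ x' (interim σ x z h)
  rw [integral_sub (integrable_const _) hP]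
  simp

theorem card_others (j : Fin n) : (Fintype.card (Others n j) : ℝ) = n - 1 := by
  have h1 : Fintype.card (Others n j) = n - 1 := by
    rw [Fintype.card_subtype_compl]
    simp
  have : 1 ≤ n := Nat.one_le_of_lt j.isLt
  rw [h1, Nat.cast_sub this]
  simp

theorem piF_eq_average (hn : 2 ≤ n) (hσ : 0 < σ) (j : Fin n) (h : Act) (x z : ℝ) (x' : EReal) :
    piF n σ h x z x' = ∫ θ, θ ∂interim σ x z h +
      (effort h + ∑ k : Others n j, ∫ p, above x' (p.2 k) ∂signalLaw n σ j x z h) / n - 1 := by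
  have := isProbabilityMeasure_interim hσ x z h
  have hP := integrable_PhiExt σ x' (interim σ x z h)
  simp_rw [integral_above_signalLaw hσ]
  rw [piF, integral_sub (integrable_interim hσ x z h (integrable_id_gaussianReal _ _))
    (hP.const_mul _), integral_const_mul, Finset.sum_const, Finset.card_univ, nsmul_eq_mul,
    card_others]
  have : (n : ℝ) ≠ 0 := by positivity
  field_simp
  ring

section Belief

variable {j : Fin n} {x z : ℝ} {h : Act}
  {μ : Measure ((ℝ × Act) × (Others n j → ℝ × Strategy))}

theorem integral_state (hσ : 0 < σ)
    (hμ : μ.map (fun p => (p.1, fun k => (p.2 k).1)) = signalLaw n σ j x z h) :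
    Integrable (fun q => q.1.1) μ ∧ ∫ q, q.1.1 ∂μ = ∫ θ, θ ∂interim σ x z h := by
  have h1 : μ.map (fun q => q.1.1) = interim σ x z h := by
    have h2 := congrArg (Measure.map Prod.fst) (congrArg (Measure.map Prod.fst) hμ)
    rw [map_fst_signalLaw hσ, Measure.map_map measurable_fst (measurable_typesOf j),
      Measure.map_map measurable_fst (by fun_prop),
      Measure.map_map measurable_fst (by fun_prop)] at h2
    have h3 : (Prod.fst ∘ fun θ : ℝ => (θ, h)) = id := rfl
    rw [h3, Measure.map_id] at h2
    exact h2
  have hm : Measurable fun q : (ℝ × Act) × (Others n j → ℝ × Strategy) => q.1.1 := by fun_prop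
  have hi : Integrable (fun θ : ℝ => θ) (interim σ x z h) :=
    integrable_interim hσ x z h (integrable_id_gaussianReal _ _)
  rw [← h1] at hi ⊢
  exact ⟨(integrable_map_measure measurable_id.aestronglyMeasurable hm.aemeasurable).1 hi,
    (integral_map hm.aemeasurable measurable_id.aestronglyMeasurable).symm⟩

theorem integral_above_belief
    (hμ : μ.map (fun p => (p.1, fun k => (p.2 k).1)) = signalLaw n σ j x z h) (x' : EReal)
    (k : Others n j) :
    ∫ q, above x' (q.2 k).1 ∂μ = ∫ p, above x' (p.2 k) ∂signalLaw n σ j x z h := by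
  have hm : Measurable fun p : (ℝ × Act) × (Others n j → ℝ) => above x' (p.2 k) :=
    (measurable_above x').comp (by fun_prop : Measurable
      fun p : (ℝ × Act) × (Others n j → ℝ) => p.2 k)
  rw [← hμ, integral_map (measurable_typesOf j).aemeasurable hm.aestronglyMeasurable]

theorem integral_payoff_follower [IsProbabilityMeasure μ] (hσ : 0 < σ)
    (hμ : μ.map (fun p => (p.1, fun k => (p.2 k).1)) = signalLaw n σ j x z h) :
    ∫ q, payoff q.1.1 (followerAggregate n j h fun k => (q.2 k).2) ∂μ =
      ∫ θ, θ ∂interim σ x z h + (effort h + ∑ k, ∫ q, effort ((q.2 k).2 h) ∂μ) / n - 1 := by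
  rw [← (integral_state hσ hμ).2]
  exact integral_add_average μ (integral_state hσ hμ).1 (measurable_otherActions j h) _ _

theorem piF_le_integral_payoff [IsProbabilityMeasure μ] (hn : 2 ≤ n) (hσ : 0 < σ)
    (hμ : μ.map (fun p => (p.1, fun k => (p.2 k).1)) = signalLaw n σ j x z h) {x' : EReal}
    (hle : ∀ᵐ q ∂μ, ∀ k, above x' (q.2 k).1 ≤ effort ((q.2 k).2 h)) :
    piF n σ h x z x' ≤ ∫ q, payoff q.1.1 (followerAggregate n j h fun k => (q.2 k).2) ∂μ := by
  rw [integral_payoff_follower hσ hμ, piF_eq_average hn hσ j]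
  gcongr with k
  rw [← integral_above_belief hμ]
  refine integral_mono_ae (integrable_above μ x' (by fun_prop))
    (integrable_effort μ (measurable_otherActions j h k)) ?_
  filter_upwards [hle] with q hq using hq k

theorem integral_payoff_le_piF [IsProbabilityMeasure μ] (hn : 2 ≤ n) (hσ : 0 < σ)
    (hμ : μ.map (fun p => (p.1, fun k => (p.2 k).1)) = signalLaw n σ j x z h) {x' : EReal}
    (hle : ∀ᵐ q ∂μ, ∀ k, effort ((q.2 k).2 h) ≤ above x' (q.2 k).1) :
    ∫ q, payoff q.1.1 (followerAggregate n j h fun k => (q.2 k).2) ∂μ ≤ piF n σ h x z x' := by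
  rw [integral_payoff_follower hσ hμ, piF_eq_average hn hσ j]
  gcongr with k
  rw [← integral_above_belief hμ]
  refine integral_mono_ae (integrable_effort μ (measurable_otherActions j h k))
    (integrable_above μ x' (by fun_prop)) ?_
  filter_upwards [hle] with q hq using hq k

theorem ae_interim_of_ae (hσ : 0 < σ)
    (hμ : μ.map (fun p => (p.1, fun k => (p.2 k).1)) = signalLaw n σ j x z h) {s : Set (ℝ × Act)}
    (hs : MeasurableSet s) (hae : ∀ᵐ q ∂μ, q.1 ∈ s) : ∀ᵐ θ ∂interim σ x z h, (θ, h) ∈ s := by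
  have h2 := congrArg (Measure.map Prod.fst) hμ
  rw [map_fst_signalLaw hσ, Measure.map_map measurable_fst (measurable_typesOf j)] at h2
  have h3 : (Prod.fst ∘ fun p : (ℝ × Act) × (Others n j → ℝ × Strategy) =>
      (p.1, fun k => (p.2 k).1)) = Prod.fst := rfl
  rw [h3] at h2
  have h4 : ∀ᵐ p ∂μ.map Prod.fst, p ∈ s := (ae_map_iff measurable_fst.aemeasurable hs).2 hae
  rw [h2] at h4
  exact (ae_map_iff (by fun_prop) hs).1 h4

end Belief

/-- The interim law charges every set of positive volume inside the conditioning event. This lets a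
belief concentrated on the leader's surviving set restrict the believed threshold. -/
theorem volume_eq_zero_of_ae_interim (hσ : 0 < σ) {x z : ℝ} {h : Act} {p : ℝ → Prop}
    (hae : ∀ᵐ θ ∂interim σ x z h, p θ) : volume {θ | thresholdStrategy z θ = h ∧ ¬p θ} = 0 := by
  by_contra hne
  have h1 : interim σ x z h {θ | ¬p θ} = 0 := hae
  rw [interim, cond_apply (measurableSet_thresholdStrategy z h), mul_eq_zero] at h1
  rcases h1 with h1 | h1
  · exact measure_ne_top _ _ (ENNReal.inv_eq_zero.1 h1)
  · exact gaussianReal_ne_zero_of_volume (toNNReal_sq_ne_zero hσ) hne h1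

theorem exists_followerBelief (hn : 2 ≤ n) (hσ : 0 < σ) (j : Fin n) (x z : ℝ) (h : Act)
    {x' : Act → EReal} {xE xN : EReal} (hE : x' Act.E ≤ xE) (hN : xN ≤ x' Act.N)
    {RL : Set (ℝ × Act)} (hRL : MeasurableSet RL)
    (hz : ∀ θ, thresholdStrategy z θ = h → (θ, h) ∈ RL) :
    ∃ μ : Measure ((ℝ × Act) × (Others n j → ℝ × Strategy)), FollowerBelief n σ j x h μ ∧
      (∀ᵐ q ∂μ, q.1 ∈ RL ∧ ∀ k, q.2 k ∈ followerSet xE xN) ∧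
      ∫ q, payoff q.1.1 (followerAggregate n j h fun k => (q.2 k).2) ∂μ =
        piF n σ h x z (x' h) := by
  have hI := isProbabilityMeasure_interim hσ x z h
  have hc := measurable_cutoffStrategy x'
  set T : (ℝ × Act) × (Others n j → ℝ) → (ℝ × Act) × (Others n j → ℝ × Strategy) :=
    -- Each opponent's strategy is a deterministic function of his signal, so the prescribed law of
    -- types is preserved.
    fun p => (p.1, fun k => (p.2 k, cutoffStrategy x' (p.2 k))) with hT
  have hTm : Measurable T := by fun_prop
  have hprob : IsProbabilityMeasure (signalLaw n σ j x z h) :=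
    Measure.isProbabilityMeasure_map (measurable_signalLaw_map σ j h).aemeasurable
  have hprob' : IsProbabilityMeasure ((signalLaw n σ j x z h).map T) :=
    Measure.isProbabilityMeasure_map hTm.aemeasurable
  have hmap : ((signalLaw n σ j x z h).map T).map (fun p => (p.1, fun k => (p.2 k).1)) =
      signalLaw n σ j x z h := by
    rw [Measure.map_map (measurable_typesOf j) hTm]
    exact Measure.map_id
  have hmsF : MeasurableSet {q : (ℝ × Act) × (Others n j → ℝ × Strategy) |
      ∀ k, q.2 k ∈ followerSet xE xN} := by
    have : {q : (ℝ × Act) × (Others n j → ℝ × Strategy) | ∀ k, q.2 k ∈ followerSet xE xN} =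
        ⋂ k, (fun q => q.2 k) ⁻¹' followerSet xE xN := by ext; simp
    rw [this]
    exact MeasurableSet.iInter fun k =>
      (by fun_prop : Measurable fun q : (ℝ × Act) × (Others n j → ℝ × Strategy) => q.2 k)
        (measurableSet_followerSet xE xN)
  have hstrat : ∀ᵐ q ∂(signalLaw n σ j x z h).map T, ∀ k,
      effort ((q.2 k).2 h) = above (x' h) (q.2 k).1 := by
    have hms : MeasurableSet {q : (ℝ × Act) × (Others n j → ℝ × Strategy) | ∀ k,
        effort ((q.2 k).2 h) = above (x' h) (q.2 k).1} := by
      have : {q : (ℝ × Act) × (Others n j → ℝ × Strategy) | ∀ k,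
          effort ((q.2 k).2 h) = above (x' h) (q.2 k).1} =
          ⋂ k, {q | effort ((q.2 k).2 h) = above (x' h) (q.2 k).1} := by ext; simp
      rw [this]
      exact MeasurableSet.iInter fun k => measurableSet_eq_fun
        (measurable_effort.comp (measurable_otherActions j h k))
        ((measurable_above _).comp (by fun_prop))
    rw [ae_map_iff hTm.aemeasurable hms]
    exact Eventually.of_forall fun p k => effort_cutoffStrategy x' _ h
  refine ⟨_, ⟨hprob', z, hmap⟩, ?_, le_antisymm ?_ ?_⟩
  · refine Filter.Eventually.and ?_ ?_
    · have hms : MeasurableSet {q : (ℝ × Act) × (Others n j → ℝ × Strategy) | q.1 ∈ RL} :=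
        measurable_fst hRL
      rw [ae_map_iff hTm.aemeasurable hms]
      have h1 : ∀ᵐ p ∂(signalLaw n σ j x z h).map Prod.fst, p ∈ RL := by
        rw [map_fst_signalLaw hσ]
        refine (ae_map_iff (by fun_prop) hRL).2 ?_
        exact ae_cond_of_forall_mem (measurableSet_thresholdStrategy z h) fun θ hθ => hz θ hθ
      exact (ae_map_iff measurable_fst.aemeasurable hRL).1 h1
    · rw [ae_map_iff hTm.aemeasurable hmsF]
      exact Eventually.of_forall fun p k => mem_followerSet_cutoffStrategy hE hN _
  · exact integral_payoff_le_piF hn hσ hmap (hstrat.mono fun q hq k => (hq k).le)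
  · exact piF_le_integral_payoff hn hσ hmap (hstrat.mono fun q hq k => (hq k).ge)

/-- Only two choices can be eliminated: no effort after effort, tested at threshold 0 and cutoff
`xE`, and effort after no effort, tested at threshold `t` and cutoff `xN`. Imitating the leader is
always justified. -/
theorem followerStep_eq (hn : 2 ≤ n) (hσ : 0 < σ) {t : ℝ} (ht : 0 ≤ t) (xE xN : EReal)
    (j : Fin n) :
    followerStep n σ (leaderSet 0 t) (fun _ => followerSet xE xN) j =
      followerSet xE xN ∩ followerSet (brF n σ Act.E 0 xE) (brF n σ Act.N t xN) := by
  ext ⟨x, s⟩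
  constructor
  · rintro ⟨hRF, hb⟩
    refine ⟨hRF, fun hs => ?_, fun hs => ?_⟩
    · obtain ⟨μ, ⟨hprob, z, hμ⟩, hae, hopt⟩ := hb Act.E
      -- Otherwise states in (z, 0] would have positive probability together with effort by the
      -- leader, a pair already eliminated.
      have hz : 0 ≤ z := by
        have h0 := volume_eq_zero_of_ae_interim hσ (ae_interim_of_ae hσ hμ
          (measurableSet_leaderSet 0 t) (hae.mono fun q hq => hq.1))
        by_contra hz
        have hsub : Set.Ioc z 0 ⊆ {θ | thresholdStrategy z θ = Act.E ∧
            ¬(θ, Act.E) ∈ leaderSet 0 t} := by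
          intro θ hθ
          refine ⟨if_pos hθ.1, fun hmem => ?_⟩
          have h1 : (0 : EReal) < (θ : EReal) := hmem.1 rfl
          exact hθ.2.not_gt (by exact_mod_cast h1)
        have := measure_mono_null hsub h0
        simp at this
        exact hz this
      have hle := piF_le_integral_payoff hn hσ hμ (x' := xE)
        (hae.mono fun q hq k => above_le_effort_of_mem (hq.2 k))
      have hnp : totalGain n σ Act.E x z xE ≤ 0 := by
        rw [← piF_nonpos_iff hn hσ]
        refine hle.trans (not_lt.1 fun h => ?_)
        have := hopt.2 h
        simp_all
      rw [coe_le_brF_iff hn hσ]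
      rcases totalGain_E_of_le hn hσ (x := x) (x' := xE) hz with h | h <;> linarith
    · obtain ⟨μ, ⟨hprob, z, hμ⟩, hae, hopt⟩ := hb Act.N
      -- Otherwise states in (t, z] would be charged together with the eliminated action of no
      -- effort.
      have hz : z ≤ t := by
        have h0 := volume_eq_zero_of_ae_interim hσ (ae_interim_of_ae hσ hμ
          (measurableSet_leaderSet 0 t) (hae.mono fun q hq => hq.1))
        by_contra hz
        have hsub : Set.Ioc t z ⊆ {θ | thresholdStrategy z θ = Act.N ∧
            ¬(θ, Act.N) ∈ leaderSet 0 t} := by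
          intro θ hθ
          refine ⟨if_neg hθ.2.not_gt, fun hmem => ?_⟩
          have h1 : (θ : EReal) ≤ (t : EReal) := hmem.2 rfl
          exact hθ.1.not_ge (by exact_mod_cast h1)
        have := measure_mono_null hsub h0
        simp at this
        exact hz this
      have hle := integral_payoff_le_piF hn hσ hμ (x' := xN)
        (hae.mono fun q hq k => effort_le_above_of_mem (hq.2 k))
      have hp : 0 < totalGain n σ Act.N x z xN := by
        rw [← piF_pos_iff hn hσ]
        exact (hopt.1 hs).trans_le hle
      rw [← not_le, coe_le_brF_iff hn hσ, not_le]
      rcases totalGain_N_of_le hn hσ (x := x) (x' := xN) hz with h | h <;> linarith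
  · rintro ⟨hRF, h1, h2⟩
    refine ⟨hRF, fun h => ?_⟩
    have hmeas := measurableSet_leaderSet 0 t
    have hzE : ∀ θ, thresholdStrategy 0 θ = Act.E → (θ, Act.E) ∈ leaderSet 0 t := by
      intro θ hθ
      have : θ ∈ Set.Ioi (0 : ℝ) := setOf_thresholdStrategy_E 0 ▸ hθ
      exact ⟨fun _ => EReal.coe_pos.2 this, by simp⟩
    have hzN : ∀ z ≤ t, ∀ θ, thresholdStrategy z θ = Act.N → (θ, Act.N) ∈ leaderSet 0 t := by
      intro z hz θ hθ
      have : θ ∈ Set.Iic z := setOf_thresholdStrategy_N z ▸ hθ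
      exact ⟨by simp, fun _ => EReal.coe_le_coe_iff.2 (le_trans this hz)⟩
    cases h
    · cases hs : s Act.E
      · obtain ⟨μ, hμ, hae, hv⟩ := exists_followerBelief hn hσ j x 0 Act.E
          (x' := fun h => if h = Act.E then ⊥ else ⊤) (xE := xE) (xN := xN) (by simp) (by simp)
          hmeas hzE
        refine ⟨μ, hμ, hae, ?_⟩
        rw [Optimal, hv, if_pos rfl, piF_pos_iff hn hσ]
        simp only [hs, true_iff]
        refine totalGain_pos_of_forall hn hσ fun θ hθ => ?_
        have : 0 < θ := EReal.coe_pos.1 ((hzE θ hθ).1 rfl)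
        simpa [effortGain, effort] using this
      · obtain ⟨μ, hμ, hae, hv⟩ := exists_followerBelief hn hσ j x 0 Act.E
          (x' := fun h => if h = Act.E then xE else ⊤) (xE := xE) (xN := xN) (by simp) (by simp)
          hmeas hzE
        refine ⟨μ, hμ, hae, ?_⟩
        rw [Optimal, hv, if_pos rfl, piF_pos_iff hn hσ]
        simpa [hs] using (coe_le_brF_iff hn hσ).1 (h1 hs)
    · cases hs : s Act.N
      · obtain ⟨μ, hμ, hae, hv⟩ := exists_followerBelief hn hσ j x t Act.N
          (x' := fun h => if h = Act.E then ⊥ else xN) (xE := xE) (xN := xN) (by simp) (by simp)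
          hmeas (hzN t le_rfl)
        refine ⟨μ, hμ, hae, ?_⟩
        rw [Optimal, hv, if_neg (by simp), piF_pos_iff hn hσ]
        have := h2 hs
        rw [← not_le, coe_le_brF_iff hn hσ, not_le] at this
        simpa [hs] using this
      -- If no other follower exerts effort, the gain is θ - 1, negative on θ ≤ 0; the threshold 0
      -- is allowed because `0 ≤ t`.
      · obtain ⟨μ, hμ, hae, hv⟩ := exists_followerBelief hn hσ j x 0 Act.N
          (x' := fun h => if h = Act.E then ⊥ else ⊤) (xE := xE) (xN := xN) (by simp) (by simp)
          hmeas (hzN 0 ht)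
        refine ⟨μ, hμ, hae, ?_⟩
        rw [Optimal, hv, if_neg (by simp), piF_pos_iff hn hσ]
        have hneg : totalGain n σ Act.N x 0 ⊤ < 0 := by
          refine totalGain_neg_of_forall hn hσ fun θ hθ => ?_
          have h0 : θ ∈ Set.Iic (0 : ℝ) := setOf_thresholdStrategy_N 0 ▸ hθ
          have h3 : (n : ℝ) ≠ 0 := by positivity
          have h4 : effortGain n σ Act.N ⊤ θ = θ - 1 := by
            simp [effortGain, effort]
            field_simp
            ring
          have : θ ≤ 0 := h0
          linarith
        simpa [hs] using hneg.le

end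

/-! ### The sequences of dominance bounds -/

section

variable {n : ℕ} {σ : ℝ}

theorem effortGain_bot_E (n : ℕ) (σ θ : ℝ) : effortGain n σ Act.E ⊥ θ = θ := by
  simp [effortGain, effort]

theorem brF_E_bot (hn : 2 ≤ n) (hσ : 0 < σ) {z : ℝ} (hz : 0 ≤ z) : brF n σ Act.E z ⊥ = ⊥ := by
  refine EReal.eq_bot_iff_forall_lt _ |>.2 fun x => ?_
  rw [← not_le, coe_le_brF_iff hn hσ, not_le]
  refine totalGain_pos_of_forall hn hσ fun θ hθ => ?_
  have : θ ∈ Set.Ioi z := setOf_thresholdStrategy_E z ▸ hθ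
  rw [effortGain_bot_E]
  exact hz.trans_lt this

theorem brF_N_antitone (hn : 2 ≤ n) (hσ : 0 < σ) {z z₁ : ℝ} (hz : z ≤ z₁) (x' : EReal) :
    brF n σ Act.N z₁ x' ≤ brF n σ Act.N z x' := by
  refine EReal.le_of_forall_lt_iff_le.1 fun x hx => ?_
  by_contra hlt
  have h1 := (coe_lt_brF_iff hn hσ).1 (not_le.1 hlt)
  refine hx.not_gt ((coe_lt_brF_iff hn hσ).2 ?_)
  rcases totalGain_N_of_le hn hσ (x := x) (x' := x') hz with h | h <;> linarith

theorem bounds_xELo (hn : 2 ≤ n) (hσ : 0 < σ) (k : ℕ) : (bounds n σ k).xELo = ⊥ := by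
  induction k with
  | zero => rfl
  | succ k ih =>
    change brF n σ Act.E (brL σ (bounds n σ k).xEHi) (bounds n σ k).xELo = ⊥
    rw [ih, brF_E_bot hn hσ (brL_nonneg _ _)]

theorem bounds_thetaLo_succ (hn : 2 ≤ n) (hσ : 0 < σ) (k : ℕ) :
    (bounds n σ (k + 1)).thetaLo = 0 := by
  change ((brL σ (bounds n σ k).xELo : ℝ) : EReal) = 0
  rw [bounds_xELo hn hσ, brL_bot, EReal.coe_zero]

theorem bounds_thetaHi_succ (n : ℕ) (σ : ℝ) (k : ℕ) :
    (bounds n σ (k + 1)).thetaHi = (brL σ (bounds n σ k).xEHi : ℝ) := rfl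

theorem bounds_xEHi_succ (hn : 2 ≤ n) (hσ : 0 < σ) (k : ℕ) :
    (bounds n σ (k + 1)).xEHi = brF n σ Act.E 0 (bounds n σ k).xEHi := by
  change brF n σ Act.E (brL σ (bounds n σ k).xELo) (bounds n σ k).xEHi = _
  rw [bounds_xELo hn hσ, brL_bot]

theorem bounds_xNLo_succ (n : ℕ) (σ : ℝ) (k : ℕ) :
    (bounds n σ (k + 1)).xNLo =
      brF n σ Act.N (brL σ (bounds n σ k).xEHi) (bounds n σ k).xNLo := rfl

theorem antitone_xEHi (hn : 2 ≤ n) (hσ : 0 < σ) : Antitone fun k => (bounds n σ k).xEHi := by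
  refine antitone_nat_of_succ_le fun k => ?_
  induction k with
  | zero => exact le_top
  | succ k ih =>
    rw [bounds_xEHi_succ hn hσ (k + 1)]
    conv_rhs => rw [bounds_xEHi_succ hn hσ k]
    exact monotone_brF hn hσ Act.E 0 ih

theorem antitone_thetaHi (hn : 2 ≤ n) (hσ : 0 < σ) :
    Antitone fun k => (bounds n σ k).thetaHi := by
  refine antitone_nat_of_succ_le fun k => ?_
  cases k with
  | zero => exact le_top
  | succ k =>
    rw [bounds_thetaHi_succ, bounds_thetaHi_succ, EReal.coe_le_coe_iff]
    exact monotone_brL hσ (antitone_xEHi hn hσ k.le_succ)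

theorem monotone_xNLo (hn : 2 ≤ n) (hσ : 0 < σ) : Monotone fun k => (bounds n σ k).xNLo := by
  refine monotone_nat_of_le_succ fun k => ?_
  induction k with
  | zero => exact bot_le
  | succ k ih =>
    rw [bounds_xNLo_succ n σ (k + 1)]
    conv_lhs => rw [bounds_xNLo_succ n σ k]
    exact (monotone_brF hn hσ Act.N _ ih).trans
      (brF_N_antitone hn hσ (monotone_brL hσ (antitone_xEHi hn hσ k.le_succ)) _)

/-- A strictly higher opponents' cutoff makes the gain at the current finite bound strictly
negative, and lowering the leader's threshold keeps it negative, so the bound moves up strictly. The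
strictness settles the boundary signal of the limit set. -/
theorem bounds_xNLo_lt_succ (hn : 2 ≤ n) (hσ : 0 < σ) (k : ℕ) :
    (bounds n σ k).xNLo < (bounds n σ (k + 1)).xNLo ∨ (bounds n σ k).xNLo = ⊤ := by
  induction k with
  | zero =>
    left
    rw [bounds_xNLo_succ]
    exact bot_lt_iff_ne_bot.2 (brF_N_ne_bot _ _ _ _)
  | succ k ih =>
    by_cases htop : (bounds n σ (k + 1)).xNLo = ⊤
    · exact Or.inr htop
    have hbot : (bounds n σ (k + 1)).xNLo ≠ ⊥ := by
      rw [bounds_xNLo_succ]; exact brF_N_ne_bot _ _ _ _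
    have hlt : (bounds n σ k).xNLo < (bounds n σ (k + 1)).xNLo := by
      exact ih.resolve_right fun h => htop (top_le_iff.1 (h ▸ monotone_xNLo hn hσ k.le_succ))
    left
    obtain ⟨x, hx⟩ : ∃ x : ℝ, (bounds n σ (k + 1)).xNLo = x :=
      ⟨_, (EReal.coe_toReal htop hbot).symm⟩
    have h0 : totalGain n σ Act.N x (brL σ (bounds n σ k).xEHi) (bounds n σ k).xNLo ≤ 0 := by
      rw [← coe_le_brF_iff hn hσ, ← bounds_xNLo_succ, hx]
    have h1 := (totalGain_strictAnti hn hσ Act.N x (brL σ (bounds n σ k).xEHi) hlt).trans_le h0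
    have hz : brL σ (bounds n σ (k + 1)).xEHi ≤ brL σ (bounds n σ k).xEHi :=
      monotone_brL hσ (antitone_xEHi hn hσ k.le_succ)
    rw [bounds_xNLo_succ n σ (k + 1)]
    conv_lhs => rw [hx]
    rw [coe_lt_brF_iff hn hσ]
    rcases totalGain_N_of_le hn hσ (x := x) (x' := (bounds n σ (k + 1)).xNLo) hz with h | h
    · exact h
    · exact h.trans_lt h1

/-! ### The rationalizable sets -/

theorem leaderSet_mono {lo lo' hi hi' : EReal} (hlo : lo' ≤ lo) (hhi : hi ≤ hi') :
    leaderSet lo hi ⊆ leaderSet lo' hi' :=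
  fun _ hp => ⟨fun h => hlo.trans_lt (hp.1 h), fun h => (hp.2 h).trans hhi⟩

theorem followerSet_mono {xE xE' xN xN' : EReal} (hE : xE ≤ xE') (hN : xN' ≤ xN) :
    followerSet xE xN ⊆ followerSet xE' xN' :=
  fun _ hp => ⟨fun h => (hp.1 h).trans hE, fun h => hN.trans_lt (hp.2 h)⟩

/-- Monotonicity of the bounds makes each round's intersection with the previous set collapse to the
new set. -/
theorem ratRound_eq (hn : 2 ≤ n) (hσ : 0 < σ) (k : ℕ) :
    ratRound n σ k = (leaderSet (bounds n σ k).thetaLo (bounds n σ k).thetaHi,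
      fun _ => followerSet (bounds n σ k).xEHi (bounds n σ k).xNLo) := by
  induction k with
  | zero =>
    refine Prod.ext ?_ (funext fun j => ?_)
    · ext p
      simp [ratRound, bounds, leaderSet]
    · ext p
      simp [ratRound, bounds, followerSet]
  | succ k ih =>
    have hlo : (bounds n σ k).thetaLo ≤ 0 := by
      cases k with
      | zero => exact bot_le
      | succ k => exact (bounds_thetaLo_succ hn hσ k).le
    have hL : leaderStep n σ (ratRound n σ k).1 (ratRound n σ k).2 =
        leaderSet 0 (brL σ (bounds n σ k).xEHi : ℝ) := by
      rw [ih, leaderStep_eq hn hσ]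
      exact Set.inter_eq_right.2 (leaderSet_mono hlo (antitone_thetaHi hn hσ k.le_succ))
    refine Prod.ext ?_ (funext fun j => ?_)
    · change leaderStep n σ (ratRound n σ k).1 (ratRound n σ k).2 = _
      rw [hL, bounds_thetaLo_succ hn hσ, bounds_thetaHi_succ]
    · change followerStep n σ (leaderStep n σ (ratRound n σ k).1 (ratRound n σ k).2)
        (ratRound n σ k).2 j = _
      rw [hL, ih, followerStep_eq hn hσ (brL_nonneg _ _), ← bounds_xEHi_succ hn hσ,
        ← bounds_xNLo_succ]
      exact Set.inter_eq_right.2 (followerSet_mono (antitone_xEHi hn hσ k.le_succ)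
        (monotone_xNLo hn hσ k.le_succ))

theorem exists_iInf_thetaHi_eq (n : ℕ) (σ : ℝ) :
    ∃ θ : ℝ, 0 ≤ θ ∧ ⨅ k, (bounds n σ k).thetaHi = (θ : EReal) := by
  have h0 : (0 : EReal) ≤ ⨅ k, (bounds n σ k).thetaHi := by
    refine le_iInf fun k => ?_
    cases k with
    | zero => exact le_top
    | succ k =>
      rw [bounds_thetaHi_succ]
      exact EReal.coe_nonneg.2 (brL_nonneg _ _)
  have h1 : ⨅ k, (bounds n σ k).thetaHi < ⊤ :=
    (iInf_le _ 1).trans_lt (EReal.coe_lt_top _)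
  have h2 : ⨅ k, (bounds n σ k).thetaHi ≠ ⊥ := fun h => by simp [h] at h0
  refine ⟨(⨅ k, (bounds n σ k).thetaHi).toReal, EReal.toReal_nonneg h0, ?_⟩
  rw [EReal.coe_toReal h1.ne h2]

theorem limitThresholds_iff (hn : 2 ≤ n) (hσ : 0 < σ) (θ : ℝ) (xE xN : EReal) :
    LimitThresholds n σ θ xE xN ↔ ⨅ k, (bounds n σ k).thetaHi = (θ : EReal) ∧
      ⨅ k, (bounds n σ k).xEHi = xE ∧ ⨆ k, (bounds n σ k).xNLo = xN := by
  have h1 := tendsto_atTop_iInf (antitone_thetaHi hn hσ)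
  have h2 := tendsto_atTop_iInf (antitone_xEHi hn hσ)
  have h3 := tendsto_atTop_iSup (monotone_xNLo hn hσ)
  constructor
  · rintro ⟨ha, hb, hc⟩
    exact ⟨tendsto_nhds_unique h1 ha, tendsto_nhds_unique h2 hb, tendsto_nhds_unique h3 hc⟩
  · rintro ⟨ha, hb, hc⟩
    exact ⟨ha ▸ h1, hb ▸ h2, hc ▸ h3⟩

theorem mem_leaderRat_iff (hn : 2 ≤ n) (hσ : 0 < σ) {θbar : ℝ}
    (hθ : ⨅ k, (bounds n σ k).thetaHi = (θbar : EReal)) {p : ℝ × Act} :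
    p ∈ leaderRat n σ ↔ (p.2 = Act.E → 0 < p.1) ∧ (p.2 = Act.N → p.1 ≤ θbar) := by
  simp only [leaderRat, Set.mem_iInter, ratRound_eq hn hσ]
  constructor
  · intro h
    refine ⟨fun hE => ?_, fun hN => ?_⟩
    · have := (h 1).1 hE
      rw [bounds_thetaLo_succ hn hσ] at this
      exact EReal.coe_pos.1 this
    · rw [← EReal.coe_le_coe_iff, ← hθ]
      exact le_iInf fun k => (h k).2 hN
  · rintro ⟨h1, h2⟩ k
    refine ⟨fun hE => ?_, fun hN => ?_⟩
    · cases k with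
      | zero => exact EReal.bot_lt_coe _
      | succ k =>
        rw [bounds_thetaLo_succ hn hσ]
        exact EReal.coe_pos.2 (h1 hE)
    · exact (EReal.coe_le_coe_iff.2 (h2 hN)).trans (hθ ▸ iInf_le _ k)

theorem mem_followerRat_iff (hn : 2 ≤ n) (hσ : 0 < σ) {j : Fin n} {q : ℝ × Strategy} :
    q ∈ followerRat n σ j ↔
      (q.2 Act.E = Act.N → (q.1 : EReal) ≤ ⨅ k, (bounds n σ k).xEHi) ∧
        (q.2 Act.N = Act.E → ⨆ k, (bounds n σ k).xNLo ≤ (q.1 : EReal)) := by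
  simp only [followerRat, Set.mem_iInter, ratRound_eq hn hσ]
  constructor
  · intro h
    exact ⟨fun hE => le_iInf fun k => (h k).1 hE, fun hN => iSup_le fun k => ((h k).2 hN).le⟩
  · rintro ⟨h1, h2⟩ k
    refine ⟨fun hE => (h1 hE).trans (iInf_le _ k), fun hN => ?_⟩
    -- Each round requires a strict inequality but the limit only a weak one: a finite supremum is
    -- never reached, so a signal equal to it still exceeds every bound.
    rcases bounds_xNLo_lt_succ hn hσ k with h | h
    · exact h.trans_le ((le_iSup (fun k => (bounds n σ k).xNLo) (k + 1)).trans (h2 hN))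
    · have := (le_iSup (fun k => (bounds n σ k).xNLo) k).trans (h2 hN)
      rw [h] at this
      simp at this

/-! ### Unique play -/

theorem mem_leaderRat_iff_of_limit (hn : 2 ≤ n) (hσ : 0 < σ) (h : LimitThresholds n σ 0 ⊥ ⊤)
    {p : ℝ × Act} : p ∈ leaderRat n σ ↔ (p.2 = Act.E ↔ 0 < p.1) := by
  rw [mem_leaderRat_iff hn hσ ((limitThresholds_iff hn hσ _ _ _).1 h).1]
  obtain ⟨θ, a⟩ := p
  cases a <;> simp

theorem mem_followerRat_iff_of_limit (hn : 2 ≤ n) (hσ : 0 < σ) (h : LimitThresholds n σ 0 ⊥ ⊤)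
    {j : Fin n} {q : ℝ × Strategy} : q ∈ followerRat n σ j ↔ ∀ h, q.2 h = h := by
  obtain ⟨-, h2, h3⟩ := (limitThresholds_iff hn hσ _ _ _).1 h
  rw [mem_followerRat_iff hn hσ, h2, h3]
  simp only [le_bot_iff, EReal.coe_ne_bot, top_le_iff, EReal.coe_ne_top, imp_false]
  constructor
  · rintro ⟨hE, hN⟩ (_ | _)
    · cases hs : q.2 Act.E <;> simp_all
    · cases hs : q.2 Act.N <;> simp_all
  · intro hq
    simp [hq]

theorem uniquePlay_iff (hn : 2 ≤ n) (hσ : 0 < σ) :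
    UniquePlay n σ ↔ LimitThresholds n σ 0 ⊥ ⊤ := by
  constructor
  · rintro ⟨hL, hF⟩
    obtain ⟨θ, hθ0, hθ⟩ := exists_iInf_thetaHi_eq n σ
    have hj : 0 < n := by omega
    rw [limitThresholds_iff hn hσ]
    refine ⟨?_, ?_, ?_⟩
    · rcases hθ0.eq_or_lt with h | h
      · rw [hθ, ← h]
      · have := (hL θ).unique (y₁ := Act.E) (y₂ := Act.N)
          ((mem_leaderRat_iff hn hσ hθ).2 (by simpa using h))
          ((mem_leaderRat_iff hn hσ hθ).2 (by simp))
        simp at this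
    · by_contra hne
      -- At a signal below the limit, both imitation and never exerting effort survive.
      obtain ⟨x, -, hx⟩ := EReal.lt_iff_exists_real_btwn.1 (bot_lt_iff_ne_bot.2 hne)
      have := (hF ⟨0, hj⟩ x).unique (y₁ := fun _ => Act.N) (y₂ := id)
        ((mem_followerRat_iff hn hσ).2 ⟨fun _ => hx.le, by simp⟩)
        ((mem_followerRat_iff hn hσ).2 (by simp))
      simpa using congrFun this Act.E
    · by_contra hne
      obtain ⟨x, hx, -⟩ := EReal.lt_iff_exists_real_btwn.1 (lt_top_iff_ne_top.2 hne)
      have := (hF ⟨0, hj⟩ x).unique (y₁ := fun _ => Act.E) (y₂ := id)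
        ((mem_followerRat_iff hn hσ).2 ⟨by simp, fun _ => hx.le⟩)
        ((mem_followerRat_iff hn hσ).2 (by simp))
      simpa using congrFun this Act.N
  · intro h
    refine ⟨fun θ => ?_, fun j x => ⟨id, (mem_followerRat_iff_of_limit hn hσ h).2 fun _ => rfl,
      fun s hs => funext ((mem_followerRat_iff_of_limit hn hσ h).1 hs)⟩⟩
    simp only [mem_leaderRat_iff_of_limit hn hσ h]
    by_cases hθ : 0 < θ
    · exact ⟨Act.E, by simp [hθ], fun a ha => ha.2 hθ⟩
    · refine ⟨Act.N, by simp [hθ], fun a ha => ?_⟩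
      cases a
      · exact absurd (ha.1 rfl) hθ
      · rfl

/-! ### When the upper bounds after effort diverge -/

/-- A real point with nonpositive diagonal gain stays below every bound, by induction and
monotonicity in the cutoff. Conversely, a finite limit of the recursion has nonpositive diagonal
gain by continuity. -/
theorem iInf_xEHi_eq_bot_iff (hn : 2 ≤ n) (hσ : 0 < σ) :
    ⨅ k, (bounds n σ k).xEHi = ⊥ ↔ ∀ x : ℝ, 0 < totalGain n σ Act.E x 0 (x : EReal) := by
  constructor
  · intro h x
    by_contra hx
    have hle : ∀ k, (x : EReal) ≤ (bounds n σ k).xEHi := by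
      intro k
      induction k with
      | zero => exact le_top
      | succ k ih =>
        rw [bounds_xEHi_succ hn hσ, coe_le_brF_iff hn hσ]
        exact ((totalGain_strictAnti hn hσ Act.E x 0).antitone ih).trans (not_lt.1 hx)
    have := le_iInf hle
    rw [h] at this
    simp at this
  · intro hpos
    by_contra hbot
    have hne : ∀ k, (bounds n σ (k + 1)).xEHi ≠ ⊤ := fun k => by
      rw [bounds_xEHi_succ hn hσ]; exact brF_E_ne_top _ _ _ _
    have htop : ⨅ k, (bounds n σ k).xEHi ≠ ⊤ := fun h => hne 0 (iInf_eq_top.1 h 1)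
    have hbk : ∀ k, (bounds n σ k).xEHi ≠ ⊥ := fun k h =>
      hbot (le_bot_iff.1 (h ▸ iInf_le (fun k => (bounds n σ k).xEHi) k))
    have hcoe : ∀ k, (((bounds n σ (k + 1)).xEHi.toReal : ℝ) : EReal) =
        (bounds n σ (k + 1)).xEHi := fun k => EReal.coe_toReal (hne k) (hbk _)
    set y := (⨅ k, (bounds n σ k).xEHi).toReal with hy
    have hlim : Tendsto (fun k => (bounds n σ (k + 1)).xEHi.toReal) atTop (𝓝 y) :=
      ((EReal.tendsto_toReal htop hbot).comp (tendsto_atTop_iInf (antitone_xEHi hn hσ))).comp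
        (tendsto_add_atTop_nat 1)
    have hlim2 : Tendsto (fun k => ((bounds n σ (k + 1 + 1)).xEHi.toReal,
        (bounds n σ (k + 1)).xEHi.toReal)) atTop (𝓝 (y, y)) :=
      (hlim.comp (tendsto_add_atTop_nat 1)).prodMk_nhds hlim
    have hlim3 := ((continuous_totalGain_E_diag hn hσ 0).tendsto (y, y)).comp hlim2
    refine (hpos y).not_ge (le_of_tendsto hlim3 (Eventually.of_forall fun k => ?_))
    simp only [Function.comp]
    rw [← coe_le_brF_iff hn hσ, hcoe, hcoe, ← bounds_xEHi_succ hn hσ]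

theorem exists_brL_lt (hσ : 0 < σ) (h : ⨅ k, (bounds n σ k).xEHi = ⊥) {ε : ℝ}
    (hε : 0 < ε) : ∃ k, brL σ (bounds n σ k).xEHi < ε := by
  -- The leader's threshold solves θ = Φ((x - θ)/σ) with θ ≥ 0, so it is at most Φ(x/σ), which is
  -- below ε once x ≤ σy.
  obtain ⟨y, hy⟩ := ((tendsto_cdf_atBot (gaussianReal 0 1)).eventually (gt_mem_nhds hε)).exists
  obtain ⟨k, hk⟩ := iInf_lt_iff.1 (h ▸ EReal.bot_lt_coe (σ * y))
  refine ⟨k, (monotone_brL hσ hk.le).trans_lt (lt_of_le_of_lt ?_ hy)⟩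
  rw [brL_eq_PhiExt, PhiExt_coe]
  refine monotone_cdf _ ?_
  rw [div_le_iff₀ hσ]
  linarith [brL_nonneg σ ((σ * y : ℝ) : EReal)]

theorem limitThresholds_of_iInf_xEHi (hn : 2 ≤ n) (hσ : 0 < σ)
    (h : ⨅ k, (bounds n σ k).xEHi = ⊥) : LimitThresholds n σ 0 ⊥ ⊤ := by
  rw [limitThresholds_iff hn hσ]
  refine ⟨?_, h, ?_⟩
  · obtain ⟨θ, hθ0, hθ⟩ := exists_iInf_thetaHi_eq n σ
    rcases hθ0.eq_or_lt with h0 | h0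
    · rw [hθ, ← h0]
    · obtain ⟨k, hk⟩ := exists_brL_lt hσ h h0
      have : (θ : EReal) ≤ (bounds n σ (k + 1)).thetaHi := hθ ▸ iInf_le _ (k + 1)
      rw [bounds_thetaHi_succ, EReal.coe_le_coe_iff] at this
      exact absurd hk this.not_gt
  · have hn0 : (0 : ℝ) < 1 / n := by positivity
    -- After no effort the leader's absent contribution costs 1/n; once all states believed possible
    -- lie below 1/n, the gain is negative at every signal, so ∞ is reached in finitely many rounds.
    obtain ⟨k, hk⟩ := exists_brL_lt hσ h hn0
    have : (bounds n σ (k + 1)).xNLo = ⊤ := by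
      rw [bounds_xNLo_succ]
      refine EReal.eq_top_iff_forall_lt _ |>.2 fun x => (coe_lt_brF_iff hn hσ).2 ?_
      refine totalGain_neg_of_forall hn hσ fun θ hθ => ?_
      have h1 : θ ∈ Set.Iic (brL σ (bounds n σ k).xEHi) := setOf_thresholdStrategy_N _ ▸ hθ
      have h2 := mul_nonneg (others_share_pos hn).le (PhiExt_nonneg σ (bounds n σ k).xNLo θ)
      have h3 : θ ≤ brL σ (bounds n σ k).xEHi := h1
      simp only [effortGain, effort, if_neg (show Act.N ≠ Act.E by simp), sub_zero]
      linarith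
    exact top_le_iff.1 (this ▸ le_iSup (fun k => (bounds n σ k).xNLo) (k + 1))

end

/-! ### The cutoff for the noise -/

/-- `E[(t + v)⁺]` for a standard Gaussian `v`. -/
noncomputable def positivePart (t : ℝ) : ℝ := ∫ v in Set.Ioi (-t), (t + v) ∂gaussianReal 0 1

/-- `E[Φ(-v); v > -t]` for a standard Gaussian `v`. -/
noncomputable def upperMass (t : ℝ) : ℝ :=
  ∫ v in Set.Ioi (-t), cdf (gaussianReal 0 1) (-v) ∂gaussianReal 0 1

theorem integrable_const_add_gaussian (t : ℝ) :
    Integrable (fun v => t + v) (gaussianReal 0 1) :=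
  (integrable_const _).add (integrable_id_gaussianReal _ _)

theorem integrable_cdf_neg :
    Integrable (fun v => cdf (gaussianReal 0 1) (-v)) (gaussianReal 0 1) := by
  refine (integrable_const (1 : ℝ)).mono'
    (continuous_cdf_stdGaussian.comp continuous_neg).aestronglyMeasurable
    (Eventually.of_forall fun v => ?_)
  rw [Real.norm_of_nonneg (cdf_nonneg _ _)]
  exact cdf_le_one _ _

/-- In units of σ, an opponent's signal falls below the common cutoff with probability Φ(-v),
whatever σ is. So σ enters only as a factor of the first term. -/
theorem totalGain_diag {n : ℕ} {σ : ℝ} (hσ : 0 < σ) (t : ℝ) :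
    totalGain n σ Act.E (σ * t) 0 ((σ * t : ℝ) : EReal) =
      σ * positivePart t - ((n : ℝ) - 1) / n * upperMass t := by
  have h1 : ∀ v, effortGain n σ Act.E ((σ * t : ℝ) : EReal) (σ * t + σ * v) =
      σ * (t + v) - ((n : ℝ) - 1) / n * cdf (gaussianReal 0 1) (-v) := by
    intro v
    have : (σ * t - (σ * t + σ * v)) / σ = -v := by field_simp; ring
    rw [effortGain, PhiExt_coe, this]
    simp [effort]
    ring
  have h2 : (0 - σ * t) / σ = -t := by field_simp; ring
  rw [totalGain_eq hσ, h2, setOf_thresholdStrategy_E]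
  simp_rw [h1]
  rw [integral_sub ((integrable_const_add_gaussian t).const_mul _).restrict
    (integrable_cdf_neg.const_mul _).restrict, integral_const_mul,
    integral_const_mul]
  rfl

theorem continuous_positivePart : Continuous positivePart := by
  have := continuous_integral_thresholdStrategy (a := fun t : ℝ => -t) continuous_neg
    (f := fun t v => t + v) (fun v => by fun_prop) (fun t => by fun_prop) (fun t₀ => ?_) Act.E
  · simp only [setOf_thresholdStrategy_E] at this
    exact this
  · refine ⟨|t₀| + 1, ?_⟩
    have h1 : ∀ᶠ t : ℝ in 𝓝 t₀, |t| < |t₀| + 1 :=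
      continuous_abs.continuousAt.eventually (gt_mem_nhds (by linarith))
    filter_upwards [h1] with t ht v
    have h3 := abs_add_le t v
    have h4 : 0 ≤ |t₀| * |v| := by positivity
    linarith

theorem continuous_upperMass : Continuous upperMass := by
  have := continuous_integral_thresholdStrategy (a := fun t : ℝ => -t) continuous_neg
    (f := fun _ v => cdf (gaussianReal 0 1) (-v)) (fun v => by fun_prop)
    (fun t => (continuous_cdf_stdGaussian.comp continuous_neg).measurable) (fun t₀ => ?_) Act.E
  · simp only [setOf_thresholdStrategy_E] at this
    exact this
  · refine ⟨1, Eventually.of_forall fun t v => ?_⟩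
    rw [abs_of_nonneg (cdf_nonneg _ _)]
    linarith [cdf_le_one (gaussianReal 0 1) (-v), abs_nonneg v]

theorem stdGaussian_Ioi_ne_zero (a : ℝ) : gaussianReal 0 1 (Set.Ioi a) ≠ 0 :=
  gaussianReal_ne_zero_of_volume (by simp) (by simp)

theorem positivePart_pos (t : ℝ) : 0 < positivePart t := by
  have := setIntegral_lt_setIntegral measurableSet_Ioi (stdGaussian_Ioi_ne_zero (-t))
    (integrable_zero _ _ _) (integrable_const_add_gaussian t)
    fun v hv => by have : -t < v := hv; change 0 < t + v; linarith
  simpa [positivePart] using this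

theorem upperMass_pos (t : ℝ) : 0 < upperMass t := by
  have := setIntegral_lt_setIntegral measurableSet_Ioi (stdGaussian_Ioi_ne_zero (-t))
    (integrable_zero _ _ _) integrable_cdf_neg fun v _ => cdf_stdGaussian_pos (-v)
  simpa [upperMass] using this

theorem le_positivePart (t : ℝ) : t ≤ positivePart t := by
  have h1 := integral_add_compl (measurableSet_Ioi (a := -t)) (integrable_const_add_gaussian t)
  have h2 : ∫ v in (Set.Ioi (-t))ᶜ, (t + v) ∂gaussianReal 0 1 ≤ 0 :=
    setIntegral_nonpos measurableSet_Ioi.compl fun v hv => by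
      have : v ≤ -t := not_lt.1 hv
      linarith
  rw [integral_add (integrable_const _) (integrable_id_gaussianReal _ _),
    integral_id_gaussianReal] at h1
  simp at h1
  rw [positivePart]
  simp at h2
  linarith

theorem upperMass_le_mul {t : ℝ} {a : ℝ} (ha : cdf (gaussianReal 0 1) t ≤ a) :
    upperMass t ≤ (gaussianReal 0 1).real (Set.Ioi (-t)) * a := by
  have : upperMass t ≤ ∫ v in Set.Ioi (-t), a ∂gaussianReal 0 1 :=
    setIntegral_mono_on integrable_cdf_neg.integrableOn (integrable_const _) measurableSet_Ioi
      fun v hv => (monotone_cdf _ (by have : -t < v := hv; linarith)).trans ha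
  simpa using this

theorem upperMass_le_one (t : ℝ) : upperMass t ≤ 1 := by
  have := upperMass_le_mul (cdf_le_one (gaussianReal 0 1) t)
  rw [mul_one] at this
  exact this.trans measureReal_le_one

/-! ### Gaussian tail estimates and the maximum of the ratio. -/

theorem cdf_stdGaussian_le_exp {t : ℝ} (ht : t ≤ 0) :
    cdf (gaussianReal 0 1) t ≤ Real.exp (-t ^ 2 / 2) := by
  have := measure_le_le_exp_mul_mgf (μ := gaussianReal 0 1) (X := id) t ht
    (integrable_exp_mul_gaussianReal t)
  rw [mgf_id_gaussianReal, ← Real.exp_add] at this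
  rw [cdf_eq_real]
  refine this.trans_eq ?_
  congr 1
  simp
  ring

theorem stdGaussian_Ioi_le_exp {s : ℝ} (hs : 0 ≤ s) :
    (gaussianReal 0 1).real (Set.Ioi s) ≤ Real.exp (-s ^ 2 / 2) := by
  have := measure_ge_le_exp_mul_mgf (μ := gaussianReal 0 1) (X := id) s hs
    (integrable_exp_mul_gaussianReal s)
  rw [mgf_id_gaussianReal, ← Real.exp_add] at this
  refine (measureReal_mono fun v hv => ?_).trans (this.trans_eq ?_)
  · exact le_of_lt (show s < v from hv)
  · congr 1
    simp
    ring

/-- On the unit interval (1 - t, 2 - t] the integrand t + v is at least 1 and the density is at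
least its value at the right end. -/
theorem gaussianPDFReal_le_positivePart {t : ℝ} (ht : t ≤ 0) :
    gaussianPDFReal 0 1 (2 - t) ≤ positivePart t := by
  have h1 : ∫ v in Set.Ioc (1 - t) (2 - t), (1 : ℝ) ∂gaussianReal 0 1 ≤
      ∫ v in Set.Ioc (1 - t) (2 - t), (t + v) ∂gaussianReal 0 1 :=
    setIntegral_mono_on (integrable_const _) (integrable_const_add_gaussian t).integrableOn
      measurableSet_Ioc fun v hv => by linarith [hv.1]
  have h2 : ∫ v in Set.Ioc (1 - t) (2 - t), (t + v) ∂gaussianReal 0 1 ≤ positivePart t := by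
    refine setIntegral_mono_set (integrable_const_add_gaussian t).integrableOn ?_
      (Eventually.of_forall fun v hv => ?_)
    · filter_upwards [ae_restrict_mem measurableSet_Ioi] with v hv
      have : -t < v := hv
      simp only [Pi.zero_apply]
      linarith
    · have : 1 - t < v := hv.1
      change -t < v
      linarith
  refine le_trans ?_ (h1.trans h2)
  rw [setIntegral_const, smul_eq_mul, mul_one, measureReal_def,
    gaussianReal_apply_eq_integral _ (by simp), ENNReal.toReal_ofReal
      (setIntegral_nonneg measurableSet_Ioc fun v _ => gaussianPDFReal_nonneg _ _ _)]
  have h3 : ∫ _v in Set.Ioc (1 - t) (2 - t), gaussianPDFReal 0 1 (2 - t) ≤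
      ∫ v in Set.Ioc (1 - t) (2 - t), gaussianPDFReal 0 1 v := by
    refine setIntegral_mono_on (integrable_const _)
      (integrable_gaussianPDFReal 0 1).integrableOn measurableSet_Ioc fun v hv => ?_
    rw [gaussianPDFReal, gaussianPDFReal]
    have hv1 : 0 ≤ v := by linarith [hv.1]
    have hv2 : v ^ 2 ≤ (2 - t) ^ 2 := pow_le_pow_left₀ hv1 hv.2 2
    refine mul_le_mul_of_nonneg_left (Real.exp_le_exp.2 ?_) (by positivity)
    simp only [sub_zero, NNReal.coe_one, mul_one]
    linarith
  have h4 : (2 - t) - (1 - t) = 1 := by ring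
  simpa [h4] using h3

/-- The ratio whose maximum determines the cutoff. -/
noncomputable def massRatio (t : ℝ) : ℝ := upperMass t / positivePart t

theorem tendsto_massRatio_atTop : Tendsto massRatio atTop (𝓝 0) := by
  refine squeeze_zero' (Eventually.of_forall fun t =>
    (div_pos (upperMass_pos t) (positivePart_pos t)).le) ?_ tendsto_inv_atTop_zero
  filter_upwards [eventually_gt_atTop 0] with t ht
  rw [massRatio, ← one_div]
  exact div_le_div₀ zero_le_one (upperMass_le_one t) ht (le_positivePart t)

/-- The numerator is at most a product of two Gaussian tails, hence at most exp(-t²), while the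
denominator decays only like a single one. -/
theorem tendsto_massRatio_atBot : Tendsto massRatio atBot (𝓝 0) := by
  have hlim : Tendsto (fun t : ℝ => √(2 * Real.pi) * Real.exp (2 + t)) atBot (𝓝 0) := by
    rw [← mul_zero √(2 * Real.pi)]
    exact (Real.tendsto_exp_atBot.comp (tendsto_atBot_add_const_left _ 2 tendsto_id)).const_mul _
  refine squeeze_zero' (Eventually.of_forall fun t =>
    (div_pos (upperMass_pos t) (positivePart_pos t)).le) ?_ hlim
  -- The exponent comparison -t² ≤ 2 + t - (2 - t)²/2 amounts to t² + 6t ≥ 0.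
  filter_upwards [eventually_le_atBot (-6)] with t ht
  have ht0 : t ≤ 0 := by linarith
  have h1 : upperMass t ≤ Real.exp (-t ^ 2) := by
    refine (upperMass_le_mul (cdf_stdGaussian_le_exp ht0)).trans ?_
    refine (mul_le_mul_of_nonneg_right (stdGaussian_Ioi_le_exp (s := -t) (by linarith))
      (Real.exp_pos _).le).trans_eq ?_
    rw [← Real.exp_add]
    congr 1
    ring
  have h2 := gaussianPDFReal_le_positivePart ht0
  rw [massRatio, div_le_iff₀ (positivePart_pos t)]
  have hpi : 0 < √(2 * Real.pi) := by positivity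
  calc upperMass t ≤ Real.exp (-t ^ 2) := h1
    _ ≤ Real.exp (2 + t + -(2 - t) ^ 2 / 2) := by
      rw [Real.exp_le_exp]
      nlinarith
    _ = √(2 * Real.pi) * Real.exp (2 + t) * gaussianPDFReal 0 1 (2 - t) := by
      rw [Real.exp_add, gaussianPDFReal]
      simp only [NNReal.coe_one, mul_one, sub_zero]
      field_simp
    _ ≤ √(2 * Real.pi) * Real.exp (2 + t) * positivePart t := by gcongr

theorem exists_max_massRatio : ∃ t₀, ∀ t, massRatio t ≤ massRatio t₀ := by
  have hc : Continuous massRatio :=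
    continuous_upperMass.div continuous_positivePart fun t => (positivePart_pos t).ne'
  have h0 : 0 < massRatio 0 := div_pos (upperMass_pos 0) (positivePart_pos 0)
  refine hc.exists_forall_ge' 0 ?_
  rw [cocompact_eq_atBot_atTop, eventually_sup]
  exact ⟨tendsto_massRatio_atBot.eventually (ge_mem_nhds h0),
    tendsto_massRatio_atTop.eventually (ge_mem_nhds h0)⟩

theorem totalGain_diag_pos_iff {n : ℕ} {σ : ℝ} (hn : 2 ≤ n) (hσ : 0 < σ) {t₀ : ℝ}
    (ht₀ : ∀ t, massRatio t ≤ massRatio t₀) :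
    (∀ x : ℝ, 0 < totalGain n σ Act.E x 0 (x : EReal)) ↔
      ((n : ℝ) - 1) / n * massRatio t₀ < σ := by
  have key : ∀ t, 0 < totalGain n σ Act.E (σ * t) 0 ((σ * t : ℝ) : EReal) ↔
      ((n : ℝ) - 1) / n * massRatio t < σ := fun t => by
    rw [totalGain_diag hσ, sub_pos, massRatio, ← mul_div_assoc, div_lt_iff₀ (positivePart_pos t)]
  refine ⟨fun h => (key t₀).1 (h _), fun h x => ?_⟩
  have hx := (key (x / σ)).2
    ((mul_le_mul_of_nonneg_left (ht₀ _) (others_share_pos hn).le).trans_lt h)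
  rwa [mul_div_cancel₀ x hσ.ne'] at hx

theorem limitThresholds_zero_bot_top_iff {n : ℕ} {σ : ℝ} (hn : 2 ≤ n) (hσ : 0 < σ) {t₀ : ℝ}
    (ht₀ : ∀ t, massRatio t ≤ massRatio t₀) :
    LimitThresholds n σ 0 ⊥ ⊤ ↔ ((n : ℝ) - 1) / n * massRatio t₀ < σ := by
  rw [← totalGain_diag_pos_iff hn hσ ht₀, ← iInf_xEHi_eq_bot_iff hn hσ]
  exact ⟨fun h => ((limitThresholds_iff hn hσ _ _ _).1 h).2.1,
    limitThresholds_of_iInf_xEHi hn hσ⟩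

end LeaderGame

theorem proposition1 (n : ℕ) (hn : 2 ≤ n) :
    -- the rationalizable sets
    (∀ σ : ℝ, 0 < σ → ∃ (θbar : ℝ) (xE xN : EReal),
      Tendsto (fun k => (bounds n σ k).thetaLo) atTop (𝓝 (0 : EReal)) ∧
      LimitThresholds n σ θbar xE xN ∧
      leaderRat n σ = Set.univ \
        {p : ℝ × Act | (p.2 = Act.E ∧ p.1 ≤ 0) ∨ (p.2 = Act.N ∧ θbar < p.1)} ∧
      ∀ j : Fin n, followerRat n σ j = Set.univ \
        {q : ℝ × Strategy | (q.2 Act.E = Act.N ∧ xE < (q.1 : EReal)) ∨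
          (q.2 Act.N = Act.E ∧ (q.1 : EReal) < xN)}) ∧
    -- uniqueness holds exactly when the limit thresholds are `(0, -∞, ∞)`
    (∀ σ : ℝ, 0 < σ → (UniquePlay n σ ↔ LimitThresholds n σ 0 ⊥ ⊤)) ∧
    -- the cutoff
    (∃! σhat : ℝ, ∀ σ : ℝ, 0 < σ →
      ((UniquePlay n σ ∧ LimitThresholds n σ 0 ⊥ ⊤) ↔ σhat < σ)) ∧
    -- the unique profile is efficient, and followers imitate the leader
    (∀ σ : ℝ, 0 < σ → UniquePlay n σ →
      leaderRat n σ = {p : ℝ × Act | p.2 = Act.E ↔ 0 < p.1} ∧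
      ∀ j : Fin n, followerRat n σ j =
        {q : ℝ × Strategy | ∀ h : Act, q.2 h = h}) := by
  refine ⟨fun σ hσ => ?_, fun σ hσ => uniquePlay_iff hn hσ, ?_, fun σ hσ hU => ?_⟩
  · obtain ⟨θ, -, hθ⟩ := exists_iInf_thetaHi_eq n σ
    refine ⟨θ, _, _, ?_, (limitThresholds_iff hn hσ _ _ _).2 ⟨hθ, rfl, rfl⟩, ?_, fun j => ?_⟩
    · rw [← tendsto_add_atTop_iff_nat 1]
      simp only [bounds_thetaLo_succ hn hσ]
      exact tendsto_const_nhds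
    · ext p
      rw [mem_leaderRat_iff hn hσ hθ]
      simp [not_or]
    · ext q
      rw [mem_followerRat_iff hn hσ]
      simp only [Set.mem_sdiff, Set.mem_univ, true_and, Set.mem_ofPred_eq, not_or, not_and, not_lt]
  · obtain ⟨t₀, ht₀⟩ := exists_max_massRatio
    have hiff : ∀ σ : ℝ, 0 < σ → ((UniquePlay n σ ∧ LimitThresholds n σ 0 ⊥ ⊤) ↔
        ((n : ℝ) - 1) / n * massRatio t₀ < σ) := fun σ hσ => by
      rw [uniquePlay_iff hn hσ, and_self, limitThresholds_zero_bot_top_iff hn hσ ht₀]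
    have hpos : 0 < ((n : ℝ) - 1) / n * massRatio t₀ :=
      mul_pos (others_share_pos hn) (div_pos (upperMass_pos t₀) (positivePart_pos t₀))
    refine ⟨_, hiff, fun s hs => ?_⟩
    -- The condition is known only for σ > 0, but the maximal ratio gives a positive cutoff. Testing
    -- at that cutoff shows that `s` is at least as large, hence positive, and testing at `s` gives
    -- equality.
    have heq : ∀ σ : ℝ, 0 < σ → (((n : ℝ) - 1) / n * massRatio t₀ < σ ↔ s < σ) :=
      fun σ hσ => (hiff σ hσ).symm.trans (hs σ hσ)
    have h1 : ((n : ℝ) - 1) / n * massRatio t₀ ≤ s :=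
      not_lt.1 fun h => lt_irrefl _ ((heq _ hpos).2 h)
    exact le_antisymm (not_lt.1 fun h => lt_irrefl _ ((heq s (hpos.trans_le h1)).1 h)) h1
  · have hlim := (uniquePlay_iff hn hσ).1 hU
    exact ⟨Set.ext fun p => mem_leaderRat_iff_of_limit hn hσ hlim,
      fun j => Set.ext fun q => mem_followerRat_iff_of_limit hn hσ hlim⟩
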